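/- **Setting.** Let $V$ be a finite totally ordered set of vertices which is the disjoint union of layers $V_0,\dots,V_{m-1}$ (write $t(v)$ for the index of the layer of $v$), let $T=\{0,\dots,m-1\}$, and let $s:V\to S$ be a labelling that is injective on every layer. Let $\widetilde G=(V,E_S\cup E_T)$ be a connected simple weighted graph in which every (spatial) edge in $E_S$ joins two vertices of the same layer, every (temporal) edge in $E_T$ joins two vertices with the same label in different layers, and every edge $e$ has a weight $w(e)>0$ and the length $\ell(e)=1/w(e)$. Edges are written as $e=(\underline e,\overline e)$ with $\underline e<\overline e$. The points of $\widetilde G$ are its vertices and the points $u=(\underline u,\overline u,\delta)$ in the interior of the edge $(\underline u,\overline u)$ at relative distance $\delta\in(0,1)$ from $\underline u$. The *lifespan* $\mathrm{ls}(e)\subseteq T$ of a spatial edge $e=(v_1,v_2)$ is the largest set $A\ni t(v_1)$ of consecutive elements of $T$ such that for every $t\in A$ there is a spatial edge $(v_1',v_2')$ in layer $t$ with $s(v_1')=s(v_1)$ and $s(v_2')=s(v_2)$. Its *life* $\mathrm{lf}(e)$ is the set of all such edges $(v_1',v_2')$ for $t\in\mathrm{ls}(e)$; for a temporal edge, $\mathrm{lf}(e)=\{e\}$.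 Let $L$ be the weighted Laplacian of $\widetilde G$ and $L^+$ its Moore–Penrose inverse. Let $Z_V$ and $Z_E$ be independent centred Gaussian processes on $\widetilde G$ as follows. On $V$, $Z_V\sim N(0,L^+)$, and $Z_V$ is linearly interpolated on every edge. $Z_E$ vanishes on $V$, and its restrictions to different lives are independent. On the life of a spatial edge $e$, $Z_E(u)=\sqrt{\ell(e')}\,B(t(\underline u),\delta)$ for $u=(\underline u,\overline u,\delta)$ on $e'\in\mathrm{lf}(e)$, where $B$ is a centred Gaussian process on $\mathrm{ls}(e)\times[0,1]$ with covariance $k_T(t_1,t_2)\,(\min(\delta_1,\delta_2)-\delta_1\delta_2)$ and $k_T$ is a temporal kernel specified below. On a temporal edge $e$, $Z_E$ is a Brownian bridge with covariance $\ell(e)(\min(\delta_1,\delta_2)-\delta_1\delta_2)$. *Linear time.* $k_T(t_1,t_2)=k_T(|t_1-t_2|)$ is a positive semidefinite kernel on $T$ with $k_T(0)=1$; put $Z=Z_V+Z_E$, a process on $X=\widetilde G$. *Periodic time.* Here $m\ge 3$, $E_T$ consists of all pairs of vertices with the same label in cyclically adjacent layers, and "consecutive" in the definition of the lifespan refers to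 the cyclic order of $T$. Let $\rho\in[0,\tfrac12)$, $\lambda\in(-1,1)$, $\beta>0$. For an edge with lifespan $T$, $k_T$ is the correlation matrix whose inverse is $\kappa\,\Theta$, where $\Theta$ is the circulant matrix with diagonal entries $1$, entries $-\rho$ at cyclically adjacent positions and $0$ elsewhere, and $\kappa>0$ is the normalising constant; for any other spatial edge $e$, $k_T(t_1,t_2)=\lambda^{j}$, with $j$ the number of steps between $t_1$ and $t_2$ inside the arc $\mathrm{ls}(e)$. Let $X$ be the set of pairs $(t,u)$ of a point $u$ of $\widetilde G$ and a true time $t\ge0$, where $t$ is a natural number congruent modulo $m$ to the layer of $u$ if $u$ lies in a layer, and $n<t<n+1$ for a natural number $n$ such that the two endpoints of the edge lie in the layers $n$ and $n+1$ modulo $m$ if $u$ is interior to a temporal edge. Put $Z(t,u)=Z_V(u)+Z_E(u)+\beta W(t)$, with $W$ a standard Wiener process independent of $(Z_V,Z_E)$. In both cases let $k_Z$ be the covariance function of $Z$ and $$d(x_1,x_2)=\operatorname{Var}\big(Z(x_1)-Z(x_2)\big)=k_Z(x_1,x_1)+k_Z(x_2,x_2)-2k_Z(x_1,x_2),\qquad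 x_1,x_2\in X.$$ **Proposition.** Let $\psi:[0,\infty)\to\mathbb R$ be continuous, non-constant, and completely monotone, that is, infinitely differentiable on $(0,\infty)$ with $(-1)^i\psi^{(i)}(x)\ge0$ for all $x>0$ and $i\ge 0$. Then, for linear as well as for periodic time, $(x_1,x_2)\mapsto\psi(d(x_1,x_2))$ is a strictly positive definite kernel on $X$: for pairwise distinct $x_1,\dots,x_n\in X$ the matrix $(\psi(d(x_i,x_j)))_{i,j}$ is symmetric positive definite. -/

import Mathlib

open MeasureTheory ProbabilityTheory
open scoped NNReal Matrix

noncomputable section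

/-! ### Kernels and completely monotone functions -/

/-- A real kernel all of whose finite Gram matrices are (symmetric) positive semidefinite. -/
def IsPosSemidefKernel {X : Type*} (k : X → X → ℝ) : Prop :=
  ∀ (n : ℕ) (x : Fin n → X), (Matrix.of fun i j => k (x i) (x j)).PosSemidef

/-- A real kernel all of whose Gram matrices at finitely many pairwise distinct points are
(symmetric) positive definite. -/
def IsStrictlyPosDefKernel {X : Type*} (k : X → X → ℝ) : Prop :=
  ∀ (n : ℕ) (x : Fin n → X), Function.Injective x → (Matrix.of fun i j => k (x i) (x j)).PosDef

/-- `ψ`, regarded as a function on `[0, ∞)`, is continuous there, smooth on `(0, ∞)`, and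
`(-1) ^ i ψ⁽ⁱ⁾ ≥ 0` on `(0, ∞)` for all `i`. The values of `ψ` at negative arguments play no
role. -/
structure IsCompletelyMonotone (ψ : ℝ → ℝ) : Prop where
  continuousOn : ContinuousOn ψ (Set.Ici 0)
  contDiffOn : ContDiffOn ℝ (⊤ : ℕ∞) ψ (Set.Ioi 0)
  nonneg : ∀ (i : ℕ) (x : ℝ), 0 < x → 0 ≤ (-1) ^ i * iteratedDeriv i ψ x

/-! ### Moore–Penrose generalised inverse -/

/-- The Penrose equations: `P` is the Moore–Penrose generalised inverse of `M`. -/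
structure IsMoorePenrose {n : Type*} [Fintype n] (M P : Matrix n n ℝ) : Prop where
  left : M * P * M = M
  right : P * M * P = P
  symm_left : (M * P)ᵀ = M * P
  symm_right : (P * M)ᵀ = P * M

theorem IsMoorePenrose.unique {n : Type*} [Fintype n] {M P Q : Matrix n n ℝ}
    (hP : IsMoorePenrose M P) (hQ : IsMoorePenrose M Q) : P = Q := by
  have h1 : M * P = M * Q := by
    have : M * P = (M * Q) * (M * P) := by rw [← Matrix.mul_assoc, hQ.left]
    rw [← hP.symm_left, this, Matrix.transpose_mul, hP.symm_left, hQ.symm_left,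
      ← Matrix.mul_assoc, hP.left]
  have h2 : P * M = Q * M := by
    have : P * M = (P * M) * (Q * M) := by
      rw [Matrix.mul_assoc P M, ← Matrix.mul_assoc M Q M, hQ.left]
    rw [← hP.symm_right, this, Matrix.transpose_mul, hP.symm_right, hQ.symm_right,
      Matrix.mul_assoc Q M, ← Matrix.mul_assoc M P M, hP.left]
  calc P = P * M * P := hP.right.symm
    _ = Q * (M * P) := by rw [h2, Matrix.mul_assoc]
    _ = Q := by rw [h1, ← Matrix.mul_assoc, hQ.right]

theorem IsMoorePenrose.exists_of_isHermitian {n : Type*} [Fintype n] {M : Matrix n n ℝ}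
    (hM : M.IsHermitian) : ∃ P, IsMoorePenrose M P := by
  classical
  have hU := hM.eigenvectorUnitary.2
  set U : Matrix n n ℝ := (hM.eigenvectorUnitary).1 with hUdef
  set D : Matrix n n ℝ := Matrix.diagonal hM.eigenvalues with hD
  have hUU : Uᵀ * U = 1 := by
    have := (Matrix.mem_unitaryGroup_iff' (A := U)).1 hU
    simpa [Matrix.star_eq_conjTranspose] using this
  have hMU : M = U * D * Uᵀ := by
    have := hM.spectral_theorem
    rw [Unitary.conjStarAlgAut_apply] at this
    simpa [Matrix.star_eq_conjTranspose, hD, hUdef, Function.comp_def] using this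
  set E : Matrix n n ℝ := Matrix.diagonal (fun i => (hM.eigenvalues i)⁻¹) with hE
  have key : ∀ A B : Matrix n n ℝ, (U * A * Uᵀ) * (U * B * Uᵀ) = U * (A * B) * Uᵀ := by
    intro A B
    calc (U * A * Uᵀ) * (U * B * Uᵀ) = U * A * (Uᵀ * U) * B * Uᵀ := by
          simp only [Matrix.mul_assoc]
      _ = U * (A * B) * Uᵀ := by rw [hUU, Matrix.mul_one]; simp only [Matrix.mul_assoc]
  have hDE : D * E * D = D := by
    rw [hD, hE, Matrix.diagonal_mul_diagonal, Matrix.diagonal_mul_diagonal]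
    congr 1; ext i
    by_cases h : hM.eigenvalues i = 0 <;> simp [h]
  have hED : E * D * E = E := by
    rw [hD, hE, Matrix.diagonal_mul_diagonal, Matrix.diagonal_mul_diagonal]
    congr 1; ext i
    by_cases h : hM.eigenvalues i = 0 <;> simp [h]
  refine ⟨U * E * Uᵀ, ?_, ?_, ?_, ?_⟩
  · rw [hMU, key, key, hDE]
  · rw [hMU, key, key, hED]
  · rw [hMU, key, hD, hE, Matrix.diagonal_mul_diagonal]
    simp [Matrix.transpose_mul, Matrix.mul_assoc]
  · rw [hMU, key, hD, hE, Matrix.diagonal_mul_diagonal]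
    simp [Matrix.transpose_mul, Matrix.mul_assoc]

/-- Every real square matrix has exactly one Moore–Penrose inverse. -/
theorem IsMoorePenrose.existsUnique {n : Type*} [Fintype n] (M : Matrix n n ℝ) :
    ∃! P, IsMoorePenrose M P := by
  classical
  have hN : (Mᵀ * M)ᵀ = Mᵀ * M := by simp [Matrix.transpose_mul]
  obtain ⟨Q, hQ⟩ := IsMoorePenrose.exists_of_isHermitian (M := Mᵀ * M)
    (by rw [Matrix.IsHermitian, Matrix.conjTranspose_eq_transpose_of_trivial, hN])
  have hQt : Qᵀ = Q := by
    refine IsMoorePenrose.unique (M := Mᵀ * M) ⟨?_, ?_, ?_, ?_⟩ hQ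
    · have := congrArg Matrix.transpose hQ.left
      simpa [Matrix.transpose_mul, Matrix.mul_assoc] using this
    · have := congrArg Matrix.transpose hQ.right
      simpa [Matrix.transpose_mul, Matrix.mul_assoc] using this
    · have := hQ.symm_right
      rw [Matrix.transpose_mul, hN] at this
      rw [this, ← this, Matrix.transpose_mul, Matrix.transpose_transpose, hN, this]
    · have := hQ.symm_left
      rw [Matrix.transpose_mul, hN] at this
      rw [this, ← this, Matrix.transpose_mul, Matrix.transpose_transpose, hN, this]
  have hcancel : M * (Q * (Mᵀ * M)) = M := by
    have h0 : (M * (Q * (Mᵀ * M)) - M)ᵀ * (M * (Q * (Mᵀ * M)) - M) = 0 := by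
      have h1 : Mᵀ * (M * (Q * (Mᵀ * M)) - M) = 0 := by
        rw [Matrix.mul_sub, ← Matrix.mul_assoc, ← Matrix.mul_assoc, hQ.left, sub_self]
      have h2 : M * (Q * (Mᵀ * M)) - M = M * (Q * (Mᵀ * M) - 1) := by
        rw [Matrix.mul_sub, Matrix.mul_one]
      rw [h2, Matrix.transpose_mul, Matrix.mul_assoc, ← h2, h1, Matrix.mul_zero]
    have := Matrix.conjTranspose_mul_self_eq_zero.1
      (by rwa [Matrix.conjTranspose_eq_transpose_of_trivial] :
        (M * (Q * (Mᵀ * M)) - M)ᴴ * (M * (Q * (Mᵀ * M)) - M) = 0)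
    exact sub_eq_zero.1 this
  have hP : IsMoorePenrose M (Q * Mᵀ) := by
    refine ⟨?_, ?_, ?_, ?_⟩
    · simpa [Matrix.mul_assoc] using hcancel
    · have := congrArg (· * Mᵀ) hQ.right
      simpa [Matrix.mul_assoc] using this
    · simp [Matrix.transpose_mul, hQt, Matrix.mul_assoc]
    · simpa [Matrix.mul_assoc] using hQ.symm_right
  exact ⟨_, hP, fun P' h => h.unique hP⟩

/-- The Moore–Penrose generalised inverse of a real square matrix. -/
def moorePenrose {n : Type*} [Fintype n] (M : Matrix n n ℝ) : Matrix n n ℝ :=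
  (IsMoorePenrose.existsUnique M).exists.choose

theorem moorePenrose_spec {n : Type*} [Fintype n] (M : Matrix n n ℝ) :
    IsMoorePenrose M (moorePenrose M) :=
  (IsMoorePenrose.existsUnique M).exists.choose_spec

/-! ### Time-evolving graphs -/

/-- A time-evolving graph with `m` time instants: `V` is the disjoint union of the vertex sets
`V_t = {v | time v = t}`, the graph `G_t` on `V_t` consists of the spatial edges inside `V_t`, and
`label` tells which vertices of different layers represent the same vertex. -/
structure TimeEvolvingGraph (m : ℕ) (V S : Type*) where
  time : V → Fin m
  label : V → S
  label_ne : ∀ v w, v ≠ w → time v = time w → label v ≠ label w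
  spatial : SimpleGraph V
  spatial_time : ∀ v w, spatial.Adj v w → time v = time w
  spatialWeight : V → V → ℝ
  spatialWeight_symm : ∀ v w, spatialWeight v w = spatialWeight w v
  spatialWeight_pos : ∀ v w, spatial.Adj v w → 0 < spatialWeight v w

/-- An equivalent simple time-evolving graph: a time-evolving graph completed by weighted temporal
edges, which join representatives of the same vertex at different time instants. -/
structure EquivalentSimpleGraph (m : ℕ) (V S : Type*) extends TimeEvolvingGraph m V S where
  temporal : SimpleGraph V
  temporal_label : ∀ v w, temporal.Adj v w → label v = label w
  temporal_time : ∀ v w, temporal.Adj v w → time v ≠ time w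
  temporalWeight : V → V → ℝ
  temporalWeight_symm : ∀ v w, temporalWeight v w = temporalWeight w v
  temporalWeight_pos : ∀ v w, temporal.Adj v w → 0 < temporalWeight v w

namespace EquivalentSimpleGraph

/-- The underlying graph, with edge set `E_S ∪ E_T`. -/
def graph {m : ℕ} {V S : Type*} (G : EquivalentSimpleGraph m V S) : SimpleGraph V :=
  G.spatial ⊔ G.temporal

open Classical in
/-- The weight of a pair of vertices, `0` if they are not adjacent. -/
def weight {m : ℕ} {V S : Type*} (G : EquivalentSimpleGraph m V S) (v w : V) : ℝ :=
  if G.spatial.Adj v w then G.spatialWeight v w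
  else if G.temporal.Adj v w then G.temporalWeight v w
  else 0

open Classical in
/-- The Laplacian matrix. -/
def laplacian {m : ℕ} {V S : Type*} [Fintype V] (G : EquivalentSimpleGraph m V S) :
    Matrix V V ℝ :=
  Matrix.of fun v w => if v = w then ∑ u, G.weight v u else - G.weight v w

/-- The edges, each one written as the pair `(lo, hi)` of its endpoints with `lo < hi`. -/
@[ext]
structure Edge {m : ℕ} {V S : Type*} [LinearOrder V] (G : EquivalentSimpleGraph m V S) where
  lo : V
  hi : V
  lt : lo < hi
  adj : G.graph.Adj lo hi

/-- The points of the graph with Euclidean edges: its vertices, and the points in the interior of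
its edges, an interior point being given by its relative distance `δ ∈ (0, 1)` from `lo`. -/
inductive Point {m : ℕ} {V S : Type*} [LinearOrder V] (G : EquivalentSimpleGraph m V S) where
  | vertex (v : V) : Point G
  | inner (e : G.Edge) (δ : Set.Ioo (0 : ℝ) 1) : Point G

section

variable {m : ℕ} {V S : Type*} [LinearOrder V] {G : EquivalentSimpleGraph m V S}

/-- The edge belongs to `E_S`. -/
def Edge.IsSpatial (e : G.Edge) : Prop := G.spatial.Adj e.lo e.hi

/-- The length of an edge, the inverse of its weight. -/
def Edge.length (e : G.Edge) : ℝ := (G.weight e.lo e.hi)⁻¹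

/-- The edge `e'` is a spatial edge that joins, in layer `t`, the vertices with the labels of the
endpoints of `e`. -/
def Edge.Represents (e' e : G.Edge) (t : Fin m) : Prop :=
  e'.IsSpatial ∧ G.label e'.lo = G.label e.lo ∧ G.label e'.hi = G.label e.hi ∧
    G.time e'.lo = t ∧ G.time e'.hi = t

/-- The lifespan of a spatial edge for linear time: the largest set of consecutive time instants
which contains the time of `e` and at all of which `e` exists. -/
def linearLifespan (e : G.Edge) : Set (Fin m) :=
  ⋃₀ {A | G.time e.lo ∈ A ∧ (∀ t₁ ∈ A, ∀ t₂ ∈ A, t₁ < t₂ → Set.Icc t₁ t₂ ⊆ A) ∧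
    ∀ t ∈ A, ∃ e' : G.Edge, e'.Represents e t}

/-- The lifespan of a spatial edge for circular time: as in the linear case, but with sets of time
instants that are consecutive in the cyclic order. -/
def periodicLifespan (e : G.Edge) : Set (Fin m) :=
  ⋃₀ {A | G.time e.lo ∈ A ∧
    (∀ t₁ ∈ A, ∀ t₂ ∈ A, t₁ < t₂ → Set.Icc t₁ t₂ ⊆ A ∨ Set.Ici t₂ ∪ Set.Iic t₁ ⊆ A) ∧
    ∀ t ∈ A, ∃ e' : G.Edge, e'.Represents e t}

open Classical in
/-- The life of an edge, for a given notion of lifespan. -/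
def life (ls : G.Edge → Set (Fin m)) (e : G.Edge) : Set G.Edge :=
  if e.IsSpatial then {e' | ∃ t ∈ ls e, e'.Represents e t} else {e}

namespace Point

/-- `u = (lo, hi, δ)`; a vertex `v` is written as `(v, v, 0)`. -/
def lo : G.Point → V
  | vertex v => v
  | inner e _ => e.lo

def hi : G.Point → V
  | vertex v => v
  | inner e _ => e.hi

def delta : G.Point → ℝ
  | vertex _ => 0
  | inner _ δ => δ

end Point

end

/-- The covariance function of the standard Brownian bridge. -/
def bridgeKernel (δ₁ δ₂ : ℝ) : ℝ := min δ₁ δ₂ - δ₁ * δ₂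

section

variable {m : ℕ} {V S : Type*} [LinearOrder V]

/-- The covariance function of `Z_V`: the covariance matrix `L⁺` on the vertices, extended
bilinearly along the linear interpolation on the edges. -/
def kernelV [Fintype V] (G : EquivalentSimpleGraph m V S) (u₁ u₂ : G.Point) : ℝ :=
  (1 - u₁.delta) * (1 - u₂.delta) * moorePenrose G.laplacian u₁.lo u₂.lo
    + (1 - u₁.delta) * u₂.delta * moorePenrose G.laplacian u₁.lo u₂.hi
    + u₁.delta * (1 - u₂.delta) * moorePenrose G.laplacian u₁.hi u₂.lo
    + u₁.delta * u₂.delta * moorePenrose G.laplacian u₁.hi u₂.hi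

open Classical in
/-- The covariance function of `Z_E`, for a given notion `ls` of lifespan and a temporal kernel
`K e` for every spatial edge `e`; `Z_E` vanishes at the vertices. For a temporal edge
the temporal factor is `1`. -/
def kernelE (G : EquivalentSimpleGraph m V S) (ls : G.Edge → Set (Fin m))
    (K : G.Edge → Fin m → Fin m → ℝ) : G.Point → G.Point → ℝ
  | .inner e₁ δ₁, .inner e₂ δ₂ =>
      if life ls e₁ = life ls e₂ then
        √(e₁.length * e₂.length)
          * (if e₁.IsSpatial then K e₁ (G.time e₁.lo) (G.time e₂.lo) else 1)
          * bridgeKernel δ₁ δ₂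
      else 0
  | _, _ => 0

/-- `Z_V` and `Z_E` are Gaussian processes on the probability space `(Ω, P)` as in
the construction:
* on the vertices `Z_V` is normal with mean `0` and covariance matrix `L⁺`, and it is interpolated
  linearly on every edge;
* `Z_E` vanishes at the vertices; on the life of a spatial edge it is `√ℓ(e') B(t, δ)` for a
  centred Gaussian process `B` on `ls(e) × [0, 1]` with covariance function
  `k_T(t₁, t₂) (min δ₁ δ₂ - δ₁ δ₂)`; on a temporal edge it is a Brownian bridge with covariance
  function `ℓ(e) (min δ₁ δ₂ - δ₁ δ₂)`; its restrictions to the different lives are independent;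
* `Z_V` and `Z_E` are independent. -/
structure IsConstruction [Fintype V] (G : EquivalentSimpleGraph m V S)
    (ls : G.Edge → Set (Fin m)) (K : G.Edge → Fin m → Fin m → ℝ)
    {Ω : Type*} [MeasurableSpace Ω] (P : Measure Ω) (ZV ZE : G.Point → Ω → ℝ) : Prop where
  law_vertex : HasLaw (fun ω => WithLp.toLp 2 fun v => ZV (.vertex v) ω)
    (multivariateGaussian 0 (moorePenrose G.laplacian)) P
  interpolation : ∀ (e : G.Edge) (δ : Set.Ioo (0 : ℝ) 1) (ω : Ω),
    ZV (.inner e δ) ω = (1 - δ) * ZV (.vertex e.lo) ω + δ * ZV (.vertex e.hi) ω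
  vertex_zero : ∀ (v : V) (ω : Ω), ZE (.vertex v) ω = 0
  spatial_edge : ∀ e : G.Edge, e.IsSpatial → ∃ B : Fin m → ℝ → Ω → ℝ,
    IsGaussianProcess (fun p : ls e × Set.Icc (0 : ℝ) 1 => B p.1 p.2) P ∧
    (∀ t ∈ ls e, ∀ δ ∈ Set.Icc (0 : ℝ) 1, P[B t δ] = 0) ∧
    (∀ t₁ ∈ ls e, ∀ t₂ ∈ ls e, ∀ δ₁ ∈ Set.Icc (0 : ℝ) 1, ∀ δ₂ ∈ Set.Icc (0 : ℝ) 1,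
      cov[B t₁ δ₁, B t₂ δ₂; P] = K e t₁ t₂ * bridgeKernel δ₁ δ₂) ∧
    ∀ e' ∈ life ls e, ∀ (δ : Set.Ioo (0 : ℝ) 1) (ω : Ω),
      ZE (.inner e' δ) ω = √e'.length * B (G.time e'.lo) δ ω
  temporal_edge : ∀ e : G.Edge, ¬ e.IsSpatial →
    IsGaussianProcess (fun δ : Set.Ioo (0 : ℝ) 1 => ZE (.inner e δ)) P ∧
    (∀ δ, P[ZE (.inner e δ)] = 0) ∧
    ∀ δ₁ δ₂, cov[ZE (.inner e δ₁), ZE (.inner e δ₂); P] = e.length * bridgeKernel δ₁ δ₂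
  indep_lives : iIndepFun (fun (a : Set.range (life ls)) (ω : Ω)
    (p : {e : G.Edge // life ls e = a} × Set.Ioo (0 : ℝ) 1) => ZE (.inner p.1 p.2) ω) P
  indep : IndepFun (fun ω u => ZV u ω) (fun ω u => ZE u ω) P

/-! ### Linear time -/

/-- The covariance function of `Z = Z_V + Z_E` for linear time and the temporal kernel `kT`. -/
def linearKernel [Fintype V] (G : EquivalentSimpleGraph m V S) (kT : ℕ → ℝ)
    (u₁ u₂ : G.Point) : ℝ :=
  G.kernelV u₁ u₂
    + G.kernelE linearLifespan (fun _ t₁ t₂ => kT (Nat.dist t₁ t₂)) u₁ u₂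

/-- The distance for linear time. -/
def linearDist [Fintype V] (G : EquivalentSimpleGraph m V S) (kT : ℕ → ℝ)
    (u₁ u₂ : G.Point) : ℝ :=
  G.linearKernel kT u₁ u₁ + G.linearKernel kT u₂ u₂ - 2 * G.linearKernel kT u₁ u₂

/-- `Z_V` and `Z_E` are as in the construction for linear time. -/
def IsLinearConstruction [Fintype V] (G : EquivalentSimpleGraph m V S) (kT : ℕ → ℝ)
    {Ω : Type*} [MeasurableSpace Ω] (P : Measure Ω) (ZV ZE : G.Point → Ω → ℝ) : Prop :=
  G.IsConstruction linearLifespan (fun _ t₁ t₂ => kT (Nat.dist t₁ t₂)) P ZV ZE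

/-! ### Circular time -/

/-- `G` is one period of a time-evolving periodic graph: there are `m ≥ 3` layers, and the temporal
edges are all the pairs of representatives of the same vertex in cyclically adjacent layers. -/
def IsPeriodic (G : EquivalentSimpleGraph m V S) : Prop :=
  3 ≤ m ∧ ∀ v w, G.temporal.Adj v w ↔ G.label v = G.label w ∧
    (|(G.time v : ℤ) - (G.time w : ℤ)| ≡ 1 [ZMOD m] ∨
      |(G.time v : ℤ) - (G.time w : ℤ)| ≡ -1 [ZMOD m])

/-- The admissible true times of a point: on a layer, the natural numbers that reduce modulo `m` to
the index of the layer; inside a temporal edge, the non-integer times between two consecutive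
natural numbers that reduce to the layers of its endpoints. -/
def IsTrueTime (G : EquivalentSimpleGraph m V S) (t : ℝ≥0) : G.Point → Prop
  | .vertex v => ∃ n : ℕ, t = n ∧ n % m = G.time v
  | .inner e _ =>
      (e.IsSpatial ∧ ∃ n : ℕ, t = n ∧ n % m = G.time e.lo) ∨
      (¬ e.IsSpatial ∧ ∃ n : ℕ, n < t ∧ t < n + 1 ∧
        ((n % m = G.time e.lo ∧ (n + 1) % m = G.time e.hi) ∨
          (n % m = G.time e.hi ∧ (n + 1) % m = G.time e.lo)))

/-- The points `(t, u)` of a time-evolving periodic graph, with true time `t`. -/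
def PeriodicPoint (G : EquivalentSimpleGraph m V S) : Type _ :=
  {p : ℝ≥0 × G.Point // G.IsTrueTime p.1 p.2}

end

/-- The matrix with ones on the diagonal and `-ρ` at cyclically adjacent pairs. -/
def circulantPrecision (m : ℕ) (ρ : ℝ) : Matrix (Fin m) (Fin m) ℝ :=
  1 - ρ • (SimpleGraph.cycleGraph m).adjMatrix ℝ

/-- The normalising constant `κ`. The inverse of the circulant matrix above has
a constant diagonal, and `κ` is the common value of its diagonal entries. -/
def circulantNormalizer (m : ℕ) (ρ : ℝ) : ℝ :=
  ((circulantPrecision m ρ)⁻¹).trace / m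

open Classical in
/-- The temporal kernel for circular time of an edge with lifespan `A`. If `A` consists of all time
instants, it is the correlation matrix with precision matrix `κ` times the circulant matrix.
Otherwise it is `λ ^ j`, with `j` the number of steps between the two time instants inside `A`. -/
def periodicTemporalKernel (m : ℕ) (ρ lam : ℝ) (A : Set (Fin m)) (t₁ t₂ : Fin m) : ℝ :=
  if A = Set.univ then (circulantNormalizer m ρ • circulantPrecision m ρ)⁻¹ t₁ t₂
  else lam ^ (((SimpleGraph.cycleGraph m).induce A).spanningCoe.dist t₁ t₂)

section

variable {m : ℕ} {V S : Type*} [LinearOrder V]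

/-- The covariance function of `Z = Z_V + Z_E + β W` for circular time. -/
def periodicKernel [Fintype V] (G : EquivalentSimpleGraph m V S) (ρ lam β : ℝ)
    (p₁ p₂ : G.PeriodicPoint) : ℝ :=
  G.kernelV p₁.1.2 p₂.1.2
    + G.kernelE periodicLifespan
        (fun e => periodicTemporalKernel m ρ lam (periodicLifespan e)) p₁.1.2 p₂.1.2
    + β ^ 2 * min (p₁.1.1 : ℝ) (p₂.1.1 : ℝ)

/-- The distance for circular time. -/
def periodicDist [Fintype V] (G : EquivalentSimpleGraph m V S) (ρ lam β : ℝ)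
    (p₁ p₂ : G.PeriodicPoint) : ℝ :=
  G.periodicKernel ρ lam β p₁ p₁ + G.periodicKernel ρ lam β p₂ p₂
    - 2 * G.periodicKernel ρ lam β p₁ p₂

/-- `Z_V`, `Z_E` and `W` are as in the construction for circular time: `W` is a standard Wiener
process that is independent of `(Z_V, Z_E)`. -/
def IsPeriodicConstruction [Fintype V] (G : EquivalentSimpleGraph m V S) (ρ lam : ℝ)
    {Ω : Type*} [MeasurableSpace Ω] (P : Measure Ω) (ZV ZE : G.Point → Ω → ℝ)
    (W : ℝ≥0 → Ω → ℝ) : Prop :=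
  G.IsConstruction periodicLifespan
      (fun e => periodicTemporalKernel m ρ lam (periodicLifespan e)) P ZV ZE ∧
    IsBrownianReal W P ∧
    IndepFun (fun ω => ((fun u => ZV u ω), (fun u => ZE u ω))) (fun ω t => W t ω) P

end

end EquivalentSimpleGraph

end

/-! In both settings `d` is a kernel metric: `d(x, y) = k(x, x) + k(y, y) - 2 k(x, y)` with `k`
positive semidefinite, so it is a squared distance in a Euclidean space. If `d` separates points,
the Gaussian kernels `exp (-s d)`, `s > 0`, are strictly positive definite
(`IsPosSemidefKernel.sum_exp_neg_dist_pos`). By Bernstein's theorem `ψ` is a mixture of the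
functions `exp (-s ·)`, and a non-constant `ψ` gives mass to `s > 0`.

The representing measure is never constructed. Its dual form suffices: a finite combination of point
evaluations that is nonnegative on every `exp (-s ·)` is nonnegative on `ψ`
(`IsCompletelyMonotone.sum_nonneg`). Sampling `ψ` on a grid reduces this to Hausdorff's moment
problem. Strictness comes from applying the dual form to the quadratic form of the Gaussian kernel,
corrected by evaluations at `0` and at two points where `ψ` differs
(`IsCompletelyMonotone.isStrictlyPosDefKernel`).

It remains to check the two hypotheses on `k`. The vertex part is positive semidefinite because `L⁺`
is. The edge part splits into blocks, one per life, each a product of a rank-one, a temporal and a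
bridge kernel. On a proper arc the temporal kernel is that of an autoregressive process. On the full
circle it is the inverse of a positive semidefinite circulant matrix. Separation needs only the
vertex part for points of the graph: on a connected graph `L⁺` is definite on vectors of sum zero,
and barycentric coordinates determine a point. The Wiener term separates true times. Covariance
computations identify `d` with the variance of the increments. -/

noncomputable section

/-! ### Completely monotone functions and sequences -/

open Filter Topology Set in
theorem IsCompletelyMonotone.nonneg_of_nonneg {ψ : ℝ → ℝ} (hψ : IsCompletelyMonotone ψ) {x : ℝ}
    (hx : 0 ≤ x) : 0 ≤ ψ x := by
  have hpos : ∀ y : ℝ, 0 < y → 0 ≤ ψ y := fun y hy => by simpa using hψ.nonneg 0 y hy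
  rcases hx.eq_or_lt with rfl | hx
  · have h : Tendsto ψ (𝓝[>] 0) (𝓝 (ψ 0)) :=
      (hψ.continuousOn 0 Set.self_mem_Ici).mono_left (nhdsWithin_mono _ Ioi_subset_Ici_self)
    exact ge_of_tendsto h (by filter_upwards [self_mem_nhdsWithin] with y hy using hpos y hy)
  · exact hpos x hx

theorem IsCompletelyMonotone.contDiffAt {ψ : ℝ → ℝ} (hψ : IsCompletelyMonotone ψ) {x : ℝ}
    (hx : 0 < x) : ContDiffAt ℝ (⊤ : ℕ∞) ψ x :=
  hψ.contDiffOn.contDiffAt (Ioi_mem_nhds hx)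

theorem IsCompletelyMonotone.hasDerivAt_iteratedDeriv {ψ : ℝ → ℝ} (hψ : IsCompletelyMonotone ψ)
    (i : ℕ) {x : ℝ} (hx : 0 < x) :
    HasDerivAt (iteratedDeriv i ψ) (iteratedDeriv (i + 1) ψ x) x := by
  have h : DifferentiableAt ℝ (iteratedDeriv i ψ) x := by
    have h1 : DifferentiableAt ℝ (iteratedFDeriv ℝ i ψ) x :=
      (hψ.contDiffAt hx).differentiableAt_iteratedFDeriv (by exact_mod_cast ENat.natCast_lt_top i)
    have h2 : iteratedDeriv i ψ = fun y => iteratedFDeriv ℝ i ψ y (fun _ => 1) := rfl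
    rw [h2]
    exact h1.continuousMultilinear_apply_const _
  rw [iteratedDeriv_succ]
  exact h.hasDerivAt

theorem IsCompletelyMonotone.antitoneOn_iteratedDeriv {ψ : ℝ → ℝ} (hψ : IsCompletelyMonotone ψ)
    (i : ℕ) : AntitoneOn (fun x => (-1) ^ i * iteratedDeriv i ψ x) (Set.Ioi 0) := by
  have hd : ∀ x : ℝ, 0 < x → HasDerivAt (fun x => (-1) ^ i * iteratedDeriv i ψ x)
      ((-1) ^ i * iteratedDeriv (i + 1) ψ x) x :=
    fun x hx => (hψ.hasDerivAt_iteratedDeriv i hx).const_mul _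
  refine antitoneOn_of_deriv_nonpos (convex_Ioi 0)
    (fun x hx => (hd x hx).continuousAt.continuousWithinAt)
    (fun x hx => ((hd x (by simpa using hx)).differentiableAt).differentiableWithinAt)
    (fun x hx => ?_)
  have hx' : 0 < x := by simpa using hx
  rw [(hd x hx').deriv]
  have := hψ.nonneg (i + 1) x hx'
  rw [pow_succ] at this
  linarith

/-- Complete monotonicity is inherited by the backward differences. -/
theorem IsCompletelyMonotone.sub_shift {ψ : ℝ → ℝ} (hψ : IsCompletelyMonotone ψ) {h : ℝ}
    (hh : 0 ≤ h) : IsCompletelyMonotone (fun x => ψ x - ψ (x + h)) where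
  continuousOn := hψ.continuousOn.sub <| hψ.continuousOn.comp (by fun_prop) fun x hx => by
    have : (0 : ℝ) ≤ x := hx
    show 0 ≤ x + h
    positivity
  contDiffOn := hψ.contDiffOn.sub <| hψ.contDiffOn.comp (by fun_prop) fun x hx => by
    have : (0 : ℝ) < x := hx
    show 0 < x + h
    positivity
  nonneg i x hx := by
    have hxh : 0 < x + h := by positivity
    have h1 : ContDiffAt ℝ i (fun z => ψ (z + h)) x :=
      ContDiffAt.comp x ((hψ.contDiffAt hxh).of_le (by exact_mod_cast le_top)) (by fun_prop)
    rw [iteratedDeriv_fun_sub ((hψ.contDiffAt hx).of_le (by exact_mod_cast le_top)) h1,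
      iteratedDeriv_comp_add_const, mul_sub, sub_nonneg]
    exact hψ.antitoneOn_iteratedDeriv i hx hxh (by linarith)

/-- The iterated backward differences of a sequence. -/
def iteratedDiff (a : ℕ → ℝ) : ℕ → ℕ → ℝ
  | 0, j => a j
  | r + 1, j => iteratedDiff a r j - iteratedDiff a r (j + 1)

theorem IsCompletelyMonotone.iteratedDiff_nonneg {ψ : ℝ → ℝ} (hψ : IsCompletelyMonotone ψ) {h : ℝ}
    (hh : 0 ≤ h) (r j : ℕ) : 0 ≤ iteratedDiff (fun k => ψ (k * h)) r j := by
  have key : ∀ r : ℕ, ∃ φ : ℝ → ℝ, IsCompletelyMonotone φ ∧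
      ∀ j : ℕ, iteratedDiff (fun k => ψ (k * h)) r j = φ (j * h) := by
    intro r
    induction r with
    | zero => exact ⟨ψ, hψ, fun j => rfl⟩
    | succ r ih =>
      obtain ⟨φ, hφ, e⟩ := ih
      refine ⟨_, hφ.sub_shift hh, fun j => ?_⟩
      simp only [iteratedDiff, e]
      push_cast
      ring_nf
  obtain ⟨φ, hφ, e⟩ := key r
  rw [e]
  exact hφ.nonneg_of_nonneg (by positivity)

/-! ### Completely monotone sequences and Hausdorff's moment problem -/

/-- With `E` the shift and `Δ = 1 - E`, this is the binomial expansion of `1 = (Δ + E) ^ N`. -/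
theorem sum_choose_mul_iteratedDiff (a : ℕ → ℝ) (N k : ℕ) :
    ∑ i ∈ Finset.range (N + 1), (N.choose i : ℝ) * iteratedDiff a (N - i) (k + i) = a k := by
  induction N with
  | zero => simp [iteratedDiff]
  | succ N ih =>
    rw [Finset.sum_choose_succ_mul (fun i l => iteratedDiff a l (k + i)), ← ih,
      ← Finset.sum_add_distrib]
    refine Finset.sum_congr rfl fun i hi => ?_
    have : N + 1 - i = N - i + 1 := by have := Finset.mem_range.1 hi; omega
    rw [this, iteratedDiff, ← add_assoc]
    ring

/-- The numbers `n.choose j * iteratedDiff a (n - j) j` act as masses at the points `j / n`, and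
`j.choose k / n.choose k` is a substitute for `(j / n) ^ k` that makes the moment formula exact. The
identity `C(n,j) C(j,k) = C(n,k) C(n-k,j-k)` reduces it to the preceding lemma. -/
theorem sum_choose_mul_iteratedDiff_mul_choose_div (a : ℕ → ℝ) {n k : ℕ} (hk : k ≤ n) :
    ∑ j ∈ Finset.range (n + 1), (n.choose j * iteratedDiff a (n - j) j) *
      ((j.choose k : ℝ) / n.choose k) = a k := by
  rw [← sum_choose_mul_iteratedDiff a (n - k) k, show n + 1 = k + (n - k + 1) by omega,
    Finset.sum_range_add, Finset.sum_eq_zero, zero_add]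
  · refine Finset.sum_congr rfl fun i hi => ?_
    have hc : (n.choose k : ℝ) ≠ 0 := by exact_mod_cast (Nat.choose_pos hk).ne'
    have h := Nat.choose_mul (n := n) (k := k + i) (s := k) (by omega)
    rw [Nat.add_sub_cancel_left] at h
    have h' : (n.choose (k + i) : ℝ) * (k + i).choose k = n.choose k * (n - k).choose i := by
      exact_mod_cast h
    rw [show n - (k + i) = n - k - i by omega]
    field_simp
    linear_combination iteratedDiff a (n - k - i) (k + i) * h'
  · intro j hj
    rw [Nat.choose_eq_zero_of_lt (Finset.mem_range.1 hj)]
    simp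

-- The ratio for `k + 1` is the ratio for `k` times `(j - k) / (n - k)`, which differs from `j / n`
-- by at most `k / (n - k)`. The bound is uniform in `j`.
open Filter in
theorem eventually_abs_choose_div_sub_pow_le (k : ℕ) {ε : ℝ} (hε : 0 < ε) :
    ∀ᶠ n : ℕ in atTop, ∀ j ≤ n, |(j.choose k : ℝ) / n.choose k - ((j : ℝ) / n) ^ k| ≤ ε := by
  induction k generalizing ε with
  | zero => exact Eventually.of_forall fun n j _ => by simp [hε.le]
  | succ k ih =>
    have h1 : ∀ᶠ n : ℕ in atTop, (k : ℝ) / ((n : ℝ) - k) ≤ ε / 2 := by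
      have : Tendsto (fun n : ℕ => (k : ℝ) / ((n : ℝ) - k)) atTop (nhds 0) :=
        tendsto_const_nhds.div_atTop
          (tendsto_atTop_add_const_right _ _ tendsto_natCast_atTop_atTop)
      exact this.eventually_le_const (by positivity)
    filter_upwards [ih (half_pos hε), h1, eventually_gt_atTop k] with n hn h1n hkn j hj
    have hn0 : (0 : ℝ) < n := by exact_mod_cast (by omega : 0 < n)
    have hnk : (0 : ℝ) < n - k := by rw [sub_pos]; exact_mod_cast hkn
    have hy0 : 0 ≤ (j : ℝ) / n := by positivity
    have hy1 : (j : ℝ) / n ≤ 1 := by rw [div_le_one hn0]; exact_mod_cast hj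
    have hck : (0 : ℝ) < n.choose k := by exact_mod_cast Nat.choose_pos hkn.le
    have hck1 : (0 : ℝ) < n.choose (k + 1) := by exact_mod_cast Nat.choose_pos hkn
    rcases lt_or_ge j k with hjk | hjk
    -- Both binomials vanish here, so the induction hypothesis itself bounds `(j / n) ^ k`.
    · have h2 := hn j hj
      rw [Nat.choose_eq_zero_of_lt hjk] at h2
      rw [Nat.choose_eq_zero_of_lt (by omega)]
      simp only [Nat.cast_zero, zero_div, zero_sub, abs_neg] at h2 ⊢
      rw [abs_of_nonneg (by positivity)] at h2 ⊢
      calc ((j : ℝ) / n) ^ (k + 1) ≤ ((j : ℝ) / n) ^ k := pow_le_pow_of_le_one hy0 hy1 (by omega)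
        _ ≤ ε := by linarith
    · have hjk' : (0 : ℝ) ≤ j - k := by rw [sub_nonneg]; exact_mod_cast hjk
      have hjn : (j : ℝ) ≤ n := by exact_mod_cast hj
      have e1 : (j.choose (k + 1) : ℝ) * (k + 1) = j.choose k * (j - k) := by
        have := Nat.choose_succ_right_eq j k
        rw [← Nat.cast_sub hjk]
        exact_mod_cast this
      have e2 : (n.choose (k + 1) : ℝ) * (k + 1) = n.choose k * (n - k) := by
        have := Nat.choose_succ_right_eq n k
        rw [← Nat.cast_sub hkn.le]
        exact_mod_cast this
      have e3 : (j.choose (k + 1) : ℝ) / n.choose (k + 1)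
          = (j.choose k : ℝ) / n.choose k * ((j - k) / (n - k)) := by
        rw [← mul_div_mul_right _ _ (by positivity : (k + 1 : ℝ) ≠ 0), e1, e2, mul_div_mul_comm]
      have hr1 : ((j : ℝ) - k) / (n - k) ≤ 1 := by rw [div_le_one hnk]; linarith
      have hr0 : 0 ≤ ((j : ℝ) - k) / (n - k) := by positivity
      have e4 : |((j : ℝ) - k) / (n - k) - j / n| ≤ k / (n - k) := by
        have : ((j : ℝ) - k) / (n - k) - j / n = -(k / (n - k) * (1 - j / n)) := by
          field_simp
          ring
        rw [this, abs_neg, abs_of_nonneg (by apply mul_nonneg <;> [positivity; linarith])]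
        exact mul_le_of_le_one_right (by positivity) (by linarith)
      calc |(j.choose (k + 1) : ℝ) / n.choose (k + 1) - ((j : ℝ) / n) ^ (k + 1)|
          = |((j.choose k : ℝ) / n.choose k - ((j : ℝ) / n) ^ k) * ((j - k) / (n - k))
            + ((j : ℝ) / n) ^ k * (((j : ℝ) - k) / (n - k) - j / n)| := by
              rw [e3]; congr 1; ring
        _ ≤ ε / 2 * 1 + 1 * (ε / 2) := by
              refine (abs_add_le _ _).trans (add_le_add ?_ ?_)
              · rw [abs_mul, abs_of_nonneg hr0]
                exact mul_le_mul (hn j hj) hr1 hr0 (by positivity)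
              · rw [abs_mul, abs_of_nonneg (pow_nonneg hy0 k)]
                exact mul_le_mul (pow_le_one₀ hy0 hy1) (e4.trans h1n) (abs_nonneg _) zero_le_one
        _ = ε := by ring

open Filter in
/-- **Hausdorff's moment problem**: a functional on polynomials whose moments form a completely
monotone sequence is positive on `[0, 1]`. -/
theorem neg_mul_le_sum_of_iteratedDiff_nonneg {a : ℕ → ℝ} (ha : ∀ r j, 0 ≤ iteratedDiff a r j)
    {ι : Type*} [Fintype ι] (b : ι → ℝ) (k : ι → ℕ) (C : ℝ)
    (h : ∀ y ∈ Set.Icc (0 : ℝ) 1, -C ≤ ∑ i, b i * y ^ k i) :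
    -C * a 0 ≤ ∑ i, b i * a (k i) := by
  set A := (∑ i, |b i|) * a 0 with hA
  have ha0 : 0 ≤ a 0 := ha 0 0
  have hA0 : 0 ≤ A := mul_nonneg (Finset.sum_nonneg fun i _ => abs_nonneg _) ha0
  refine le_of_forall_pos_sub_le fun ε hε => ?_
  have hδ : 0 < ε / (A + 1) := by positivity
  have hev : ∀ᶠ n : ℕ in atTop, (∀ i, k i ≤ n) ∧ 0 < n ∧ ∀ i, ∀ j ≤ n,
      |(j.choose (k i) : ℝ) / n.choose (k i) - ((j : ℝ) / n) ^ k i| ≤ ε / (A + 1) :=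
    (eventually_all.2 fun i => eventually_ge_atTop _).and <| (eventually_gt_atTop 0).and <|
      eventually_all.2 fun i => eventually_abs_choose_div_sub_pow_le (k i) hδ
  obtain ⟨n, hkn, hn0, hn⟩ := hev.exists
  -- Masses at the points `j / n`, of total `a 0`; they discretise the measure whose moments are
  -- `a`.
  set w : ℕ → ℝ := fun j => n.choose j * iteratedDiff a (n - j) j with hw
  have hw0 : ∀ j, 0 ≤ w j := fun j => mul_nonneg (by positivity) (ha _ _)
  have hwa : ∑ j ∈ Finset.range (n + 1), w j = a 0 := by
    simpa using sum_choose_mul_iteratedDiff a n 0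
  have hsum : ∑ i, b i * a (k i) = ∑ j ∈ Finset.range (n + 1), w j *
      ∑ i, b i * ((j.choose (k i) : ℝ) / n.choose (k i)) := by
    simp_rw [Finset.mul_sum]
    rw [Finset.sum_comm]
    refine Finset.sum_congr rfl fun i _ => ?_
    rw [← sum_choose_mul_iteratedDiff_mul_choose_div a (hkn i), Finset.mul_sum]
    exact Finset.sum_congr rfl fun j _ => by ring
  have hlow : ∀ j ∈ Finset.range (n + 1), w j * (-C - (∑ i, |b i|) * (ε / (A + 1))) ≤
      w j * ∑ i, b i * ((j.choose (k i) : ℝ) / n.choose (k i)) := by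
    intro j hj
    have hjn : j ≤ n := by have := Finset.mem_range.1 hj; omega
    refine mul_le_mul_of_nonneg_left ?_ (hw0 j)
    have hy := h ((j : ℝ) / n) ⟨by positivity, by
      rw [div_le_one (by exact_mod_cast hn0)]; exact_mod_cast hjn⟩
    have hd : ∑ i, b i * ((j : ℝ) / n) ^ k i - (∑ i, |b i|) * (ε / (A + 1)) ≤
        ∑ i, b i * ((j.choose (k i) : ℝ) / n.choose (k i)) := by
      rw [Finset.sum_mul, ← Finset.sum_sub_distrib]
      refine Finset.sum_le_sum fun i _ => ?_
      have h1 : |b i * ((j : ℝ) / n) ^ k i - b i * ((j.choose (k i) : ℝ) / n.choose (k i))| ≤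
          |b i| * (ε / (A + 1)) := by
        rw [← mul_sub, abs_mul, abs_sub_comm]
        exact mul_le_mul_of_nonneg_left (hn i j hjn) (abs_nonneg _)
      have := (abs_le.1 h1).2
      linarith
    linarith
  have hfin := Finset.sum_le_sum hlow
  rw [← Finset.sum_mul, hwa, ← hsum] at hfin
  have hε2 : A * (ε / (A + 1)) ≤ ε := by
    rw [mul_div_assoc', div_le_iff₀ (by positivity)]
    nlinarith
  have : a 0 * (-C - (∑ i, |b i|) * (ε / (A + 1))) = -C * a 0 - A * (ε / (A + 1)) := by
    rw [hA]; ring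
  linarith

/-! ### From decaying exponentials to completely monotone functions -/

/-- What matters is a bound free of `s`; it follows from `t * exp (-t) ≤ 1` at `t = s * x`. -/
theorem abs_exp_neg_mul_sub_exp_neg_mul_le {s x x' h : ℝ} (hs : 0 ≤ s) (hx : 0 < x) (h1 : x ≤ x')
    (h2 : x' ≤ x + h) : |Real.exp (-(s * x')) - Real.exp (-(s * x))| ≤ h / x := by
  have hh : 0 ≤ h := by linarith
  have h3 : Real.exp (-(s * x')) ≤ Real.exp (-(s * x)) := by
    apply Real.exp_le_exp.2
    nlinarith
  rw [abs_sub_comm, abs_of_nonneg (by linarith)]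
  have h4 : Real.exp (-(s * x')) = Real.exp (-(s * x)) * Real.exp (-(s * (x' - x))) := by
    rw [← Real.exp_add]; congr 1; ring
  have h5 : 1 - s * h ≤ Real.exp (-(s * (x' - x))) := by
    have := Real.add_one_le_exp (-(s * (x' - x)))
    nlinarith
  have h6 : Real.exp (-(s * x)) * (s * x) ≤ 1 := by
    have := Real.add_one_le_exp (s * x)
    have e : Real.exp (-(s * x)) * Real.exp (s * x) = 1 := by rw [← Real.exp_add]; simp
    nlinarith [Real.exp_pos (-(s * x))]
  rw [h4, le_div_iff₀ hx]
  have h7 : 0 < Real.exp (-(s * x)) := Real.exp_pos _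
  calc (Real.exp (-(s * x)) - Real.exp (-(s * x)) * Real.exp (-(s * (x' - x)))) * x
      = Real.exp (-(s * x)) * (1 - Real.exp (-(s * (x' - x)))) * x := by ring
    _ ≤ Real.exp (-(s * x)) * (s * h) * x := by gcongr; linarith
    _ = (Real.exp (-(s * x)) * (s * x)) * h := by ring
    _ ≤ 1 * h := by gcongr
    _ = h := one_mul h

open Filter Topology in
/-- A finite combination of point evaluations that is nonnegative on all decaying exponentials is
nonnegative on all completely monotone functions. -/
theorem IsCompletelyMonotone.sum_nonneg {ψ : ℝ → ℝ} (hψ : IsCompletelyMonotone ψ)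
    {ι : Type*} [Fintype ι] (b x : ι → ℝ) (hx : ∀ i, 0 ≤ x i)
    (h : ∀ s : ℝ, 0 ≤ s → 0 ≤ ∑ i, b i * Real.exp (-(s * x i))) :
    0 ≤ ∑ i, b i * ψ (x i) := by
  -- Terms with `x i = 0` count as `0` in `B`. This is harmless, since rounding up to the grid
  -- leaves such points fixed.
  set B := ∑ i, |b i| / x i with hB
  have hc1 : ∀ (N : ℕ) i, x i ≤ ⌈x i * ((N : ℝ) + 1)⌉₊ * (1 / ((N : ℝ) + 1)) := fun N i => by
    rw [mul_one_div, le_div_iff₀ (by positivity)]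
    exact Nat.le_ceil _
  have hc2 : ∀ (N : ℕ) i,
      ⌈x i * ((N : ℝ) + 1)⌉₊ * (1 / ((N : ℝ) + 1)) ≤ x i + 1 / ((N : ℝ) + 1) := fun N i => by
    have hN : (0 : ℝ) < N + 1 := by positivity
    have := Nat.ceil_lt_add_one (mul_nonneg (hx i) hN.le)
    rw [mul_one_div, div_le_iff₀ hN, add_mul, one_div_mul_cancel hN.ne']
    exact this.le
  have key : ∀ N : ℕ, -(B * (1 / ((N : ℝ) + 1))) * ψ 0 ≤
      ∑ i, b i * ψ (⌈x i * ((N : ℝ) + 1)⌉₊ * (1 / ((N : ℝ) + 1))) := by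
    intro N
    have hexp : ∀ s : ℝ, 0 ≤ s → -(B * (1 / ((N : ℝ) + 1))) ≤
        ∑ i, b i * Real.exp (-(s * (⌈x i * ((N : ℝ) + 1)⌉₊ * (1 / ((N : ℝ) + 1))))) := by
      intro s hs
      have h1 := h s hs
      have h2 : ∑ i, b i * Real.exp (-(s * x i)) - B * (1 / ((N : ℝ) + 1)) ≤
          ∑ i, b i * Real.exp (-(s * (⌈x i * ((N : ℝ) + 1)⌉₊ * (1 / ((N : ℝ) + 1))))) := by
        rw [hB, Finset.sum_mul, ← Finset.sum_sub_distrib]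
        refine Finset.sum_le_sum fun i _ => ?_
        rcases (hx i).eq_or_lt with h0 | h0
        · simp [← h0]
        · have h3 := abs_exp_neg_mul_sub_exp_neg_mul_le hs h0 (hc1 N i) (hc2 N i)
          have h4 : |b i * Real.exp (-(s * (⌈x i * ((N : ℝ) + 1)⌉₊ * (1 / ((N : ℝ) + 1))))) -
              b i * Real.exp (-(s * x i))| ≤ |b i| / x i * (1 / ((N : ℝ) + 1)) := by
            rw [← mul_sub, abs_mul]
            calc _ ≤ |b i| * (1 / ((N : ℝ) + 1) / x i) :=
                  mul_le_mul_of_nonneg_left h3 (abs_nonneg _)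
              _ = _ := by ring
          have := (abs_le.1 h4).1
          linarith
      linarith
    have hpos : ∀ y : ℝ, 0 < y → y ≤ 1 → -(B * (1 / ((N : ℝ) + 1))) ≤
        ∑ i, b i * y ^ ⌈x i * ((N : ℝ) + 1)⌉₊ := by
      intro y hy0 hy1
      -- This `s` turns `exp (-(s * (j / (N + 1))))` into `y ^ j`, so on the grid exponentials
      -- become monomials. The value `y = 0` is reached by continuity.
      have h1 := hexp (-(Real.log y * (N + 1))) (by
        have := Real.log_nonpos hy0.le hy1
        nlinarith)
      refine h1.trans_eq (Finset.sum_congr rfl fun i _ => ?_)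
      congr 1
      rw [← Real.rpow_natCast, Real.rpow_def_of_pos hy0]
      congr 1
      field_simp
    have hcm := neg_mul_le_sum_of_iteratedDiff_nonneg
      (a := fun k => ψ (k * (1 / ((N : ℝ) + 1))))
      (hψ.iteratedDiff_nonneg (by positivity)) b (fun i => ⌈x i * ((N : ℝ) + 1)⌉₊)
      (B * (1 / ((N : ℝ) + 1))) (fun y hy => by
        rcases hy.1.eq_or_lt with h0 | h0
        · have ht : Tendsto (fun y : ℝ => ∑ i, b i * y ^ ⌈x i * ((N : ℝ) + 1)⌉₊) (𝓝[>] 0)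
              (𝓝 (∑ i, b i * (0 : ℝ) ^ ⌈x i * ((N : ℝ) + 1)⌉₊)) :=
            (Continuous.tendsto (by fun_prop) 0).mono_left nhdsWithin_le_nhds
          rw [← h0]
          refine ge_of_tendsto ht ?_
          filter_upwards [Ioc_mem_nhdsGT (zero_lt_one (α := ℝ))] with z hz using hpos z hz.1 hz.2
        · exact hpos y h0 hy.2)
    simpa using hcm
  have hz : Tendsto (fun N : ℕ => 1 / ((N : ℝ) + 1)) atTop (𝓝 0) :=
    tendsto_one_div_add_atTop_nhds_zero_nat
  have hl : Tendsto (fun N : ℕ => -(B * (1 / ((N : ℝ) + 1))) * ψ 0) atTop (𝓝 0) := by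
    simpa using ((hz.const_mul B).neg).mul_const (ψ 0)
  have hg : ∀ i, Tendsto (fun N : ℕ => ⌈x i * ((N : ℝ) + 1)⌉₊ * (1 / ((N : ℝ) + 1))) atTop
      (𝓝[Set.Ici 0] (x i)) := by
    intro i
    refine tendsto_nhdsWithin_iff.2 ⟨?_, Eventually.of_forall fun N => ?_⟩
    · refine tendsto_of_tendsto_of_tendsto_of_le_of_le tendsto_const_nhds
        (h := fun N : ℕ => x i + 1 / ((N : ℝ) + 1)) (by simpa using hz.const_add (x i))
        (fun N => hc1 N i) (fun N => hc2 N i)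
    · show (0 : ℝ) ≤ _
      positivity
  have hr : Tendsto (fun N : ℕ => ∑ i, b i * ψ (⌈x i * ((N : ℝ) + 1)⌉₊ * (1 / ((N : ℝ) + 1))))
      atTop (𝓝 (∑ i, b i * ψ (x i))) :=
    tendsto_finsetSum _ fun i _ =>
      (Tendsto.comp (hψ.continuousOn (x i) (hx i)) (hg i)).const_mul (b i)
  exact le_of_tendsto_of_tendsto' hl hr key

/-! ### Positive semidefinite kernels -/

theorem Matrix.posSemidef_of_sum_nonneg {ι : Type*} [Fintype ι] {M : Matrix ι ι ℝ}
    (hs : ∀ i j, M i j = M j i) (h : ∀ c : ι → ℝ, 0 ≤ ∑ i, ∑ j, c i * c j * M i j) :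
    M.PosSemidef := by
  refine .of_dotProduct_mulVec_nonneg (Matrix.IsHermitian.ext fun i j => by simp [hs i j])
    fun c => (h c).trans_eq ?_
  simp only [dotProduct, Matrix.mulVec, Finset.mul_sum, Pi.star_apply, star_trivial]
  exact Finset.sum_congr rfl fun i _ => Finset.sum_congr rfl fun j _ => by ring

theorem Matrix.PosSemidef.sum_nonneg {ι : Type*} [Fintype ι] {M : Matrix ι ι ℝ}
    (h : M.PosSemidef) (c : ι → ℝ) : 0 ≤ ∑ i, ∑ j, c i * c j * M i j := by
  refine (h.dotProduct_mulVec_nonneg c).trans_eq ?_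
  simp only [dotProduct, Matrix.mulVec, Finset.mul_sum, Pi.star_apply, star_trivial]
  exact Finset.sum_congr rfl fun i _ => Finset.sum_congr rfl fun j _ => by ring

namespace IsPosSemidefKernel

variable {X Y : Type*} {k l : X → X → ℝ}

theorem posSemidef (hk : IsPosSemidefKernel k) {ι : Type*} [Fintype ι] (x : ι → X) :
    (Matrix.of fun i j => k (x i) (x j)).PosSemidef := by
  have := (hk _ (x ∘ (Fintype.equivFin ι).symm)).submatrix (Fintype.equivFin ι)
  convert this using 1
  ext i j
  simp

theorem symm (hk : IsPosSemidefKernel k) (x y : X) : k x y = k y x := by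
  have := (hk 2 ![x, y]).isHermitian.apply 1 0
  simpa using this

theorem sum_nonneg (hk : IsPosSemidefKernel k) {ι : Type*} [Fintype ι] (x : ι → X) (c : ι → ℝ) :
    0 ≤ ∑ i, ∑ j, c i * c j * k (x i) (x j) :=
  (hk.posSemidef x).sum_nonneg c

theorem of_sum_nonneg (hs : ∀ x y, k x y = k y x)
    (h : ∀ (n : ℕ) (x : Fin n → X) (c : Fin n → ℝ), 0 ≤ ∑ i, ∑ j, c i * c j * k (x i) (x j)) :
    IsPosSemidefKernel k :=
  fun n x => Matrix.posSemidef_of_sum_nonneg (fun _ _ => hs _ _) (h n x)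

theorem dist_nonneg (hk : IsPosSemidefKernel k) (x y : X) : 0 ≤ k x x + k y y - 2 * k x y := by
  have := hk.sum_nonneg ![x, y] ![1, -1]
  simp [Fin.sum_univ_two, hk.symm y x] at this
  linarith

theorem add (hk : IsPosSemidefKernel k) (hl : IsPosSemidefKernel l) :
    IsPosSemidefKernel fun x y => k x y + l x y :=
  fun n x => (hk n x).add (hl n x)

theorem mul (hk : IsPosSemidefKernel k) (hl : IsPosSemidefKernel l) :
    IsPosSemidefKernel fun x y => k x y * l x y :=
  fun n x => (hk n x).hadamard (hl n x)

theorem comp (hk : IsPosSemidefKernel k) (f : Y → X) :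
    IsPosSemidefKernel fun x y => k (f x) (f y) :=
  fun n x => hk n (f ∘ x)

theorem rankOne (f : X → ℝ) : IsPosSemidefKernel fun x y => f x * f y :=
  fun n x => by
    simpa [Matrix.vecMulVec, Pi.star_def] using
      Matrix.posSemidef_vecMulVec_self_star (fun i => f (x i))

theorem const {c : ℝ} (hc : 0 ≤ c) : IsPosSemidefKernel fun _ _ : X => c := by
  simpa [Real.mul_self_sqrt hc] using rankOne fun _ : X => √c

theorem finset_sum {ι : Type*} (s : Finset ι) {k : ι → X → X → ℝ}
    (h : ∀ i ∈ s, IsPosSemidefKernel (k i)) : IsPosSemidefKernel fun x y => ∑ i ∈ s, k i x y := by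
  intro n x
  have := Matrix.posSemidef_sum s fun i hi => h i hi n x
  convert this using 1
  ext i j
  simp [Matrix.sum_apply]

theorem pow (hk : IsPosSemidefKernel k) (r : ℕ) : IsPosSemidefKernel fun x y => k x y ^ r := by
  induction r with
  | zero => simpa using const (X := X) zero_le_one
  | succ r ih => simpa only [pow_succ] using ih.mul hk

open Filter Topology in
theorem of_tendsto {kn : ℕ → X → X → ℝ} (h : ∀ n, IsPosSemidefKernel (kn n))
    (hl : ∀ x y, Tendsto (fun n => kn n x y) atTop (𝓝 (k x y))) : IsPosSemidefKernel k := by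
  refine of_sum_nonneg (fun x y => tendsto_nhds_unique (hl x y) ?_) fun m x c => ?_
  · simpa only [(h _).symm x y] using hl y x
  · exact ge_of_tendsto' (tendsto_finsetSum _ fun i _ => tendsto_finsetSum _ fun j _ =>
      (hl (x i) (x j)).const_mul (c i * c j)) fun n => (h n).sum_nonneg x c

/-- Schur's product theorem handles each power, and the exponential series is a pointwise limit of
nonnegative combinations of powers. -/
theorem exp (hk : IsPosSemidefKernel k) : IsPosSemidefKernel fun x y => Real.exp (k x y) := by
  refine of_tendsto (kn := fun n x y => ∑ i ∈ Finset.range n, ((i.factorial : ℝ)⁻¹) * k x y ^ i)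
    (fun n => finset_sum _ fun i _ => (const (by positivity)).mul (hk.pow i)) fun x y => ?_
  have := (NormedSpace.expSeries_div_hasSum_exp (𝔸 := ℝ) (k x y)).tendsto_sum_nat
  rw [← Real.exp_eq_exp_ℝ] at this
  simpa [div_eq_inv_mul] using this

/-- A kernel that is positive semidefinite on the fibres of a map and vanishes off them is positive
semidefinite. -/
theorem of_fibers {Q : Type*} (q : X → Q) (h0 : ∀ x y, q x ≠ q y → k x y = 0)
    (h : ∀ a, IsPosSemidefKernel fun x y : {x // q x = a} => k x y) : IsPosSemidefKernel k := by
  classical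
  refine of_sum_nonneg (fun x y => ?_) fun n x c => ?_
  · by_cases e : q x = q y
    · exact (h (q y)).symm ⟨x, e⟩ ⟨y, rfl⟩
    · rw [h0 x y e, h0 y x (Ne.symm e)]
  · have h1 : ∑ i, ∑ j, c i * c j * k (x i) (x j) =
        ∑ a ∈ Finset.univ.image (q ∘ x), ∑ i : {i // q (x i) = a}, ∑ j : {j // q (x j) = a},
          c i * c j * k (x i) (x j) := by
      rw [← Finset.sum_fiberwise_of_maps_to (s := Finset.univ) (g := q ∘ x)
        (fun i hi => Finset.mem_image_of_mem _ hi)]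
      refine Finset.sum_congr rfl fun a _ => ?_
      rw [Finset.sum_subtype (p := fun i => q (x i) = a) _ (by simp)]
      refine Finset.sum_congr rfl fun i _ => ?_
      rw [← Finset.sum_filter_add_sum_filter_not Finset.univ (fun j => q (x j) = a),
        Finset.sum_subtype (p := fun i => q (x i) = a) _ (by simp), add_eq_left]
      refine Finset.sum_eq_zero fun j hj => ?_
      rw [h0 _ _ (by rw [i.2]; exact Ne.symm (Finset.mem_filter.1 hj).2), mul_zero]
    rw [h1]
    exact Finset.sum_nonneg fun a _ => (h a).sum_nonneg (ι := {i // q (x i) = a})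
      (fun i => ⟨x i, i.2⟩) (fun i => c i)

/-- If the quadratic form of a positive semidefinite kernel vanishes at a finite combination of
points, then so does the corresponding combination of kernel functions. -/
theorem sum_mul_eq_zero (hk : IsPosSemidefKernel k) {ι : Type*} [Fintype ι] {x : ι → X} {c : ι → ℝ}
    (h : ∑ i, ∑ j, c i * c j * k (x i) (x j) = 0) (y : X) : ∑ i, c i * k (x i) y = 0 := by
  set S := ∑ i, c i * k (x i) y with hS
  -- The quadratic form of the combination with the extra point `y` of coefficient `t`: its constant
  -- term vanishes, so its linear term must vanish too.
  have key : ∀ t : ℝ, 0 ≤ 2 * t * S + t ^ 2 * k y y := by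
    intro t
    have := hk.sum_nonneg (fun o : Option ι => o.elim y x) (fun o => o.elim t c)
    simp only [Fintype.sum_option, Option.elim_none, Option.elim_some, Finset.sum_add_distrib,
      h] at this
    have e1 : ∑ i, t * c i * k y (x i) = t * S := by
      rw [hS, Finset.mul_sum]
      exact Finset.sum_congr rfl fun i _ => by rw [hk.symm y]; ring
    have e2 : ∑ i, c i * t * k (x i) y = t * S := by
      rw [hS, Finset.mul_sum]
      exact Finset.sum_congr rfl fun i _ => by ring
    rw [e1, e2] at this
    linarith
  have hy : 0 ≤ k y y := by simpa using hk.sum_nonneg (fun _ : Unit => y) (fun _ => 1)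
  -- Close to the minimiser `-S / k y y`; the `+ 1` covers `k y y = 0`.
  have h1 := key (-S / (k y y + 1))
  have hp : 0 < k y y + 1 := by linarith
  have e : 2 * (-S / (k y y + 1)) * S + (-S / (k y y + 1)) ^ 2 * k y y =
      -(S ^ 2 * (k y y + 2)) / (k y y + 1) ^ 2 := by
    field_simp
    ring
  rw [e, le_div_iff₀ (by positivity), zero_mul] at h1
  have h2 : 0 ≤ S ^ 2 * (k y y + 2) := by positivity
  have h3 : S ^ 2 * (k y y + 2) = 0 := by linarith
  rcases mul_eq_zero.1 h3 with h4 | h4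
  · exact pow_eq_zero_iff (two_ne_zero) |>.1 h4
  · linarith

end IsPosSemidefKernel

theorem IsStrictlyPosDefKernel.of_sum_pos {X : Type*} {k : X → X → ℝ} (hs : ∀ x y, k x y = k y x)
    (h : ∀ (n : ℕ) (x : Fin n → X), Function.Injective x → ∀ c : Fin n → ℝ, c ≠ 0 →
      0 < ∑ i, ∑ j, c i * c j * k (x i) (x j)) : IsStrictlyPosDefKernel k := by
  intro n x hx
  refine .of_dotProduct_mulVec_pos (Matrix.IsHermitian.ext fun i j => by simp [hs (x i)])
    fun c hc => (h n x hx c hc).trans_eq ?_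
  simp only [dotProduct, Matrix.mulVec, Finset.mul_sum, Pi.star_apply, star_trivial,
    Matrix.of_apply]
  exact Finset.sum_congr rfl fun i _ => Finset.sum_congr rfl fun j _ => by ring

/-! ### The Gaussian kernel -/

-- A null vector of the quadratic form gives `∑ c i * exp ⟪v i, y⟫ = 0` for every `y`. The functions
-- `y ↦ exp ⟪v i, y⟫` are distinct characters of the additive group, hence linearly independent by
-- Dedekind's theorem.
open scoped RealInnerProductSpace in
theorem eq_zero_of_sum_exp_inner_eq_zero {E : Type*} [NormedAddCommGroup E] [InnerProductSpace ℝ E]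
    {ι : Type*} [Fintype ι] {v : ι → E} (hv : Function.Injective v) {c : ι → ℝ}
    (h : ∑ i, ∑ j, c i * c j * Real.exp ⟪v i, v j⟫ = 0) : c = 0 := by
  have hk : IsPosSemidefKernel fun x y : E => Real.exp ⟪x, y⟫ :=
    IsPosSemidefKernel.exp fun n x => Matrix.posSemidef_gram _ x
  have h1 : ∀ y : E, ∑ i, c i * Real.exp ⟪v i, y⟫ = 0 := hk.sum_mul_eq_zero h
  let χ : ι → (Multiplicative E →* ℝ) := fun i =>
    { toFun := fun y => Real.exp ⟪v i, y.toAdd⟫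
      map_one' := by simp
      map_mul' := fun x y => by simp [inner_add_right, Real.exp_add] }
  have hχ : Function.Injective χ := by
    intro i j hij
    refine hv (ext_inner_right ℝ fun y => ?_)
    exact Real.exp_injective (DFunLike.congr_fun hij (Multiplicative.ofAdd y))
  have hli := (linearIndependent_monoidHom (Multiplicative E) ℝ).comp χ hχ
  funext i
  refine Fintype.linearIndependent_iff.1 hli c ?_ i
  funext y
  simpa [χ] using h1 y.toAdd

theorem IsPosSemidefKernel.exists_eq_inner {X : Type*} {k : X → X → ℝ} (hk : IsPosSemidefKernel k)
    {ι : Type*} [Fintype ι] (x : ι → X) :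
    ∃ (m : ℕ) (v : ι → EuclideanSpace ℝ (Fin m)), ∀ i j, k (x i) (x j) = inner ℝ (v i) (v j) := by
  obtain ⟨m, v, h⟩ := Matrix.posSemidef_iff_eq_sum_vecMulVec.1 (hk.posSemidef x)
  refine ⟨m, fun i => WithLp.toLp 2 fun r => v r i, fun i j => ?_⟩
  have := congrFun (congrFun h i) j
  simp only [Matrix.of_apply, Matrix.sum_apply, Matrix.vecMulVec_apply,
    star_trivial] at this
  rw [this]
  simp [PiLp.inner_apply, mul_comm]

/-- The Gaussian kernel of a kernel metric is strictly positive definite. -/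
theorem IsPosSemidefKernel.sum_exp_neg_dist_pos {X : Type*} {k : X → X → ℝ}
    (hk : IsPosSemidefKernel k) (hd : ∀ x y, x ≠ y → k x x + k y y - 2 * k x y ≠ 0)
    {ι : Type*} [Fintype ι] {x : ι → X} (hx : Function.Injective x) {c : ι → ℝ} (hc : c ≠ 0)
    {s : ℝ} (hs : 0 < s) :
    0 < ∑ i, ∑ j, c i * c j *
      Real.exp (-(s * (k (x i) (x i) + k (x j) (x j) - 2 * k (x i) (x j)))) := by
  -- The factor `2 * s` matches the cross term of `-s d`; the diagonal terms are absorbed into the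
  -- coefficients `c'` below.
  obtain ⟨m, v, hv⟩ := ((IsPosSemidefKernel.const (X := X) (c := 2 * s)
    (by positivity)).mul hk).exists_eq_inner x
  have hvi : Function.Injective v := by
    intro i j hij
    by_contra hne
    refine hd (x i) (x j) (hx.ne hne) ?_
    have h1 := hv i i
    have h2 := hv j j
    have h3 := hv i j
    rw [hij] at h1 h3
    have h4 : 2 * s * (k (x i) (x i) + k (x j) (x j) - 2 * k (x i) (x j)) = 0 := by linarith
    exact (mul_eq_zero.1 h4).resolve_left (by positivity)
  set c' : ι → ℝ := fun i => c i * Real.exp (-(s * k (x i) (x i))) with hc'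
  have e : ∑ i, ∑ j, c i * c j *
      Real.exp (-(s * (k (x i) (x i) + k (x j) (x j) - 2 * k (x i) (x j)))) =
      ∑ i, ∑ j, c' i * c' j * Real.exp (inner ℝ (v i) (v j)) := by
    refine Finset.sum_congr rfl fun i _ => Finset.sum_congr rfl fun j _ => ?_
    rw [← hv i j, hc', show -(s * (k (x i) (x i) + k (x j) (x j) - 2 * k (x i) (x j))) =
      -(s * k (x i) (x i)) + -(s * k (x j) (x j)) + 2 * s * k (x i) (x j) by ring,
      Real.exp_add, Real.exp_add]
    ring
  rw [e]
  refine lt_of_le_of_ne ?_ fun h0 => hc ?_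
  · exact ((IsPosSemidefKernel.exp (k := fun x y : EuclideanSpace ℝ (Fin m) => inner ℝ x y)
      fun n x => Matrix.posSemidef_gram _ x)).sum_nonneg v c'
  · have := eq_zero_of_sum_exp_inner_eq_zero hvi h0.symm
    funext i
    have hi := congrFun this i
    simpa [hc', Real.exp_ne_zero] using hi

/-! ### Strict positive definiteness for completely monotone functions of a kernel metric -/

open Filter Topology in
/-- A continuous non-constant completely monotone function of a kernel metric is a strictly
positive definite kernel. -/
theorem IsCompletelyMonotone.isStrictlyPosDefKernel {ψ : ℝ → ℝ} (hψ : IsCompletelyMonotone ψ)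
    (hne : ∃ x y : ℝ, 0 ≤ x ∧ 0 ≤ y ∧ ψ x ≠ ψ y) {X : Type*} {k : X → X → ℝ}
    (hk : IsPosSemidefKernel k) (hd : ∀ x y, x ≠ y → k x x + k y y - 2 * k x y ≠ 0) :
    IsStrictlyPosDefKernel fun x y => ψ (k x x + k y y - 2 * k x y) := by
  obtain ⟨x₀, y₀, hx₀, hy₀, hlt⟩ : ∃ x y : ℝ, 0 ≤ x ∧ 0 ≤ y ∧ ψ y < ψ x := by
    obtain ⟨x, y, hx, hy, h⟩ := hne
    rcases h.lt_or_gt with h | h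
    exacts [⟨y, x, hy, hx, h⟩, ⟨x, y, hx, hy, h⟩]
  refine IsStrictlyPosDefKernel.of_sum_pos
    (fun x y => by rw [hk.symm x y, add_comm (k x x)]) fun n x hx c hc => ?_
  set d : Fin n → Fin n → ℝ :=
    fun i j => k (x i) (x i) + k (x j) (x j) - 2 * k (x i) (x j) with hddef
  have hd0 : ∀ i, d i i = 0 := fun i => by simp only [hddef]; ring
  have hdnn : ∀ i j, 0 ≤ d i j := fun i j => hk.dist_nonneg _ _
  have hdpos : ∀ i j, i ≠ j → 0 < d i j := fun i j hij =>
    lt_of_le_of_ne (hdnn i j) (hd _ _ (hx.ne hij)).symm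
  set q : ℝ → ℝ := fun s => ∑ i, ∑ j, c i * c j * Real.exp (-(s * d i j)) with hq
  have hqpos : ∀ s, 0 < s → 0 < q s := fun s hs => hk.sum_exp_neg_dist_pos hd hx hc hs
  have hqcont : Continuous q := by fun_prop
  have hq0 : 0 ≤ q 0 := by
    have : q 0 = (∑ i, c i) * ∑ j, c j := by simp [hq, Finset.sum_mul_sum]
    rw [this]
    exact mul_self_nonneg _
  have hqnn : ∀ s, 0 ≤ s → 0 ≤ q s := fun s hs => by
    rcases hs.eq_or_lt with rfl | hs
    exacts [hq0, (hqpos s hs).le]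
  have hnorm : 0 < ∑ i, c i * c i := by
    obtain ⟨i, hi⟩ := Function.ne_iff.1 hc
    exact Finset.sum_pos' (fun i _ => mul_self_nonneg _) ⟨i, Finset.mem_univ _, mul_self_pos.2 hi⟩
  have hqlim : Tendsto q atTop (𝓝 (∑ i, c i * c i)) := by
    have : ∑ i, c i * c i = ∑ i, ∑ j, c i * c j * (if i = j then 1 else 0) := by simp
    rw [this]
    refine tendsto_finsetSum _ fun i _ => tendsto_finsetSum _ fun j _ => Tendsto.const_mul _ ?_
    split_ifs with hij
    · subst hij
      simp [hd0]
    · exact Real.tendsto_exp_neg_atTop_nhds_zero.comp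
        (tendsto_id.atTop_mul_const (hdpos i j hij))
  by_contra hneg
  push Not at hneg
  -- The `+ 1` makes `ε * ψ 0` strictly smaller than `ψ x₀ - ψ y₀` and avoids division by zero.
  have hε : 0 < (ψ x₀ - ψ y₀) / (ψ 0 + 1) := by
    have := hψ.nonneg_of_nonneg le_rfl
    exact div_pos (sub_pos.2 hlt) (by linarith)
  set ε := (ψ x₀ - ψ y₀) / (ψ 0 + 1) with hεdef
  obtain ⟨δ, hδ, hδr⟩ : ∃ δ > 0, ∀ s : ℝ, 0 ≤ s → s ≤ δ →
      Real.exp (-(s * x₀)) - Real.exp (-(s * y₀)) ≤ ε := by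
    have hcont : Tendsto (fun s : ℝ => Real.exp (-(s * x₀)) - Real.exp (-(s * y₀)))
        (𝓝 0) (𝓝 0) := by
      have : Continuous fun s : ℝ => Real.exp (-(s * x₀)) - Real.exp (-(s * y₀)) := by fun_prop
      simpa using this.tendsto 0
    obtain ⟨δ, hδ, h⟩ := Metric.eventually_nhds_iff.1 (hcont.eventually_le_const hε)
    refine ⟨δ / 2, by positivity, fun s hs hsδ => h ?_⟩
    rw [Real.dist_eq, sub_zero, abs_of_nonneg hs]
    linarith
  -- Positivity of `q` gives a lower bound on a compact interval, and the positive limit at infinity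
  -- gives one beyond it.
  obtain ⟨η, hη, hηq⟩ : ∃ η > 0, ∀ s : ℝ, δ ≤ s → η ≤ q s := by
    obtain ⟨S, hS⟩ := eventually_atTop.1 (hqlim.eventually_const_le (half_lt_self hnorm))
    obtain ⟨s₁, hs₁, hmin⟩ := isCompact_Icc.exists_isMinOn (s := Set.Icc δ (max S δ))
      ⟨δ, le_rfl, le_max_right _ _⟩ hqcont.continuousOn
    refine ⟨min (q s₁) ((∑ i, c i * c i) / 2),
      lt_min (hqpos _ (hδ.trans_le hs₁.1)) (by positivity), fun s hs => ?_⟩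
    rcases le_or_gt s (max S δ) with h | h
    · exact (min_le_left _ _).trans (hmin ⟨hs, h⟩)
    · exact (min_le_right _ _).trans (hS s ((le_max_left _ _).trans h.le))
  -- The test combination is `η⁻¹ q(s) + ε - exp (-s x₀) + exp (-s y₀)`. For `s ≤ δ` the term `ε`
  -- dominates the difference of exponentials; for `s ≥ δ` one has `η⁻¹ q(s) ≥ 1 ≥ exp (-s x₀)`.
  -- Evaluated at `ψ`, it bounds `η⁻¹` times the quadratic form below by `ψ x₀ - ψ y₀ - ε ψ 0 > 0`.
  have hmain := hψ.sum_nonneg (ι := (Fin n × Fin n) ⊕ Fin 3)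
    (Sum.elim (fun p => η⁻¹ * (c p.1 * c p.2)) ![ε, -1, 1])
    (Sum.elim (fun p => d p.1 p.2) ![0, x₀, y₀])
    (by
      rintro (p | i)
      · exact hdnn _ _
      · fin_cases i <;> simp [hx₀, hy₀])
    (fun s hs => by
      have hsum : ∑ p : Fin n × Fin n, η⁻¹ * (c p.1 * c p.2) * Real.exp (-(s * d p.1 p.2)) =
          η⁻¹ * q s := by
        rw [Fintype.sum_prod_type]
        simp only [hq, Finset.mul_sum, mul_assoc]
      simp only [Fintype.sum_sum_type, Sum.elim_inl, Sum.elim_inr, hsum, Fin.sum_univ_three]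
      simp only [Matrix.cons_val_zero, Matrix.cons_val_one, Matrix.cons_val]
      simp only [mul_zero, neg_zero, Real.exp_zero, mul_one]
      have h1 : Real.exp (-(s * x₀)) ≤ 1 := Real.exp_le_one_iff.2 (by nlinarith)
      have h2 : 0 < Real.exp (-(s * y₀)) := Real.exp_pos _
      rcases le_total s δ with h | h
      · have := hδr s hs h
        have := mul_nonneg (inv_nonneg.2 hη.le) (hqnn s hs)
        linarith
      · have : η⁻¹ * η ≤ η⁻¹ * q s := mul_le_mul_of_nonneg_left (hηq s h) (inv_nonneg.2 hη.le)
        rw [inv_mul_cancel₀ hη.ne'] at this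
        linarith)
  have hsum : ∑ p : Fin n × Fin n, η⁻¹ * (c p.1 * c p.2) * ψ (d p.1 p.2) =
      η⁻¹ * ∑ i, ∑ j, c i * c j * ψ (d i j) := by
    rw [Fintype.sum_prod_type]
    simp only [Finset.mul_sum, mul_assoc]
  simp only [Fintype.sum_sum_type, Sum.elim_inl, Sum.elim_inr, hsum, Fin.sum_univ_three] at hmain
  simp only [Matrix.cons_val_zero, Matrix.cons_val_one, Matrix.cons_val] at hmain
  have h1 : η⁻¹ * ∑ i, ∑ j, c i * c j * ψ (d i j) ≤ 0 :=
    mul_nonpos_of_nonneg_of_nonpos (inv_nonneg.2 hη.le) hneg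
  have hψ0 := hψ.nonneg_of_nonneg le_rfl
  have h2 : ε * (ψ 0 + 1) = ψ x₀ - ψ y₀ := by
    rw [hεdef]
    exact div_mul_cancel₀ _ (by linarith)
  nlinarith

/-! ### Some positive semidefinite kernels -/

theorem isPosSemidefKernel_min : IsPosSemidefKernel fun s t : ℝ≥0 => min (s : ℝ) t := by
  intro n x
  have h := posSemidef_matrix_measure_inter (μ := (volume : Measure ℝ))
    (s := fun i => Set.Icc 0 (x i : ℝ)) (fun _ => measurableSet_Icc)
    (fun _ => isCompact_Icc.measure_ne_top)
  have e : (Matrix.of fun i j => min (x i : ℝ) (x j)) =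
      .of fun i j => (volume : Measure ℝ).real (Set.Icc 0 (x i : ℝ) ∩ Set.Icc 0 (x j : ℝ)) := by
    ext
    simp [Set.Icc_inter_Icc]
  rwa [← e] at h

/-- The Brownian bridge is a time-changed Wiener process, `(1 - a) W(a / (1 - a))`. -/
theorem isPosSemidefKernel_bridgeKernel :
    IsPosSemidefKernel fun a b : Set.Ioo (0 : ℝ) 1 => EquivalentSimpleGraph.bridgeKernel a b := by
  have h := (IsPosSemidefKernel.rankOne fun a : Set.Ioo (0 : ℝ) 1 => 1 - (a : ℝ)).mul
    (isPosSemidefKernel_min.comp fun a : Set.Ioo (0 : ℝ) 1 => Real.toNNReal ((a : ℝ) / (1 - a)))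
  have e : (fun a b : Set.Ioo (0 : ℝ) 1 => EquivalentSimpleGraph.bridgeKernel a b) =
      fun a b : Set.Ioo (0 : ℝ) 1 => (1 - (a : ℝ)) * (1 - (b : ℝ)) *
        min (Real.toNNReal ((a : ℝ) / (1 - a)) : ℝ) (Real.toNNReal ((b : ℝ) / (1 - b)) : ℝ) := by
    funext a b
    obtain ⟨a, ha0, ha1⟩ := a
    obtain ⟨b, hb0, hb1⟩ := b
    have ha : 0 < 1 - a := by linarith
    have hb : 0 < 1 - b := by linarith
    rw [EquivalentSimpleGraph.bridgeKernel, Real.coe_toNNReal _ (by positivity),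
      Real.coe_toNNReal _ (by positivity)]
    rcases le_total a b with hab | hab
    · rw [min_eq_left hab, min_eq_left (by rw [div_le_div_iff₀ ha hb]; nlinarith)]
      field_simp
    · rw [min_eq_right hab, min_eq_right (by rw [div_le_div_iff₀ hb ha]; nlinarith)]
      field_simp
  rwa [e]

/-! ### Temporal kernels: autoregression and circulant matrices -/

/-- Unit variance at time `i` of the autoregression started with variance `1` and driven by
innovations of variance `1 - lam ^ 2`. -/
theorem sum_geometric_factor (lam : ℝ) (i : ℕ) :
    ∑ r ∈ Finset.range (i + 1), (if r = 0 then 1 else 1 - lam ^ 2) * (lam ^ (i - r)) ^ 2 = 1 := by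
  induction i with
  | zero => simp
  | succ i ih =>
    rw [Finset.sum_range_succ]
    have h : ∑ r ∈ Finset.range (i + 1),
        (if r = 0 then 1 else 1 - lam ^ 2) * (lam ^ (i + 1 - r)) ^ 2 = lam ^ 2 := by
      refine Eq.trans ?_ ((congrArg (lam ^ 2 * ·) ih).trans (mul_one _))
      simp only [Finset.mul_sum]
      refine Finset.sum_congr rfl fun r hr => ?_
      rw [show i + 1 - r = i - r + 1 by have := Finset.mem_range.1 hr; omega, pow_succ]
      ring
    rw [h]
    simp

open Filter Topology in
/-- The covariance function of a stationary autoregressive process of order one. -/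
theorem isPosSemidefKernel_pow_dist {lam : ℝ} (h1 : -1 < lam) (h2 : lam < 1) :
    IsPosSemidefKernel fun i j : ℕ => lam ^ Nat.dist i j := by
  have hσ : ∀ r : ℕ, 0 ≤ (if r = 0 then 1 else 1 - lam ^ 2 : ℝ) := fun r => by
    split_ifs
    · exact zero_le_one
    · nlinarith
  -- `f r i` is the weight of innovation `r` in the state at time `i`.
  set f : ℕ → ℕ → ℝ := fun r i => if r ≤ i then lam ^ (i - r) else 0 with hf
  have hle : ∀ i j N : ℕ, i ≤ j → i < N → ∑ r ∈ Finset.range N,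
      (if r = 0 then 1 else 1 - lam ^ 2) * (f r i * f r j) = lam ^ Nat.dist i j := by
    intro i j N hij hN
    rw [← Finset.sum_subset (Finset.range_subset_range.2 hN), Nat.dist_eq_sub_of_le hij]
    · refine Eq.trans ?_ ((congrArg (· * lam ^ (j - i)) (sum_geometric_factor lam i)).trans
        (one_mul _))
      simp only [Finset.sum_mul]
      refine Finset.sum_congr rfl fun r hr => ?_
      have hri : r ≤ i := by have := Finset.mem_range.1 hr; omega
      rw [hf]
      simp only [if_pos hri, if_pos (hri.trans hij)]
      rw [show j - r = (i - r) + (j - i) by omega, pow_add]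
      ring
    · intro r _ hr
      have : ¬ r ≤ i := by have := Finset.mem_range.not.1 hr; omega
      simp [hf, this]
  refine IsPosSemidefKernel.of_tendsto (kn := fun N i j => ∑ r ∈ Finset.range N,
      (if r = 0 then 1 else 1 - lam ^ 2) * (f r i * f r j))
    (fun N => IsPosSemidefKernel.finset_sum _ fun r _ =>
      (IsPosSemidefKernel.const (hσ r)).mul (IsPosSemidefKernel.rankOne (f r))) fun i j => ?_
  -- For fixed `i` and `j` the truncated sums are eventually constant, so the limit is exact.
  refine tendsto_const_nhds.congr' ?_
  filter_upwards [eventually_gt_atTop (i + j)] with N hN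
  rcases le_total i j with hij | hij
  · exact (hle i j N hij (by omega)).symm
  · rw [Nat.dist_comm, ← hle j i N hij (by omega)]
    exact Finset.sum_congr rfl fun r _ => by ring

/-- The matrix is `(1 - 2ρ) I + ρ L` with `L` the Laplacian of the cycle; every degree is `2`
because `m ≥ 3`. -/
theorem posSemidef_circulantPrecision {m : ℕ} (hm : 3 ≤ m) {ρ : ℝ} (h0 : 0 ≤ ρ) (h1 : ρ < 1 / 2) :
    (EquivalentSimpleGraph.circulantPrecision m ρ).PosSemidef := by
  obtain ⟨n, rfl⟩ : ∃ n, m = n + 3 := ⟨m - 3, by omega⟩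
  have hL := SimpleGraph.posSemidef_lapMatrix ℝ (SimpleGraph.cycleGraph (n + 3))
  have e : EquivalentSimpleGraph.circulantPrecision (n + 3) ρ =
      (1 - 2 * ρ) • (1 : Matrix (Fin (n + 3)) (Fin (n + 3)) ℝ) +
        ρ • (SimpleGraph.cycleGraph (n + 3)).lapMatrix ℝ := by
    have hD : (SimpleGraph.cycleGraph (n + 3)).degMatrix ℝ = (2 : ℝ) • 1 := by
      ext i j
      simp [SimpleGraph.degMatrix, SimpleGraph.cycleGraph_degree_three_le, Matrix.diagonal_apply,
        Matrix.one_apply]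
    rw [EquivalentSimpleGraph.circulantPrecision, SimpleGraph.lapMatrix, hD]
    module
  rw [e]
  exact (Matrix.PosSemidef.one.smul (by linarith)).add (hL.smul h0)

theorem posSemidef_inv_circulant {m : ℕ} (hm : 3 ≤ m) {ρ : ℝ} (h0 : 0 ≤ ρ) (h1 : ρ < 1 / 2) :
    (EquivalentSimpleGraph.circulantNormalizer m ρ •
      EquivalentSimpleGraph.circulantPrecision m ρ)⁻¹.PosSemidef := by
  have h := posSemidef_circulantPrecision hm h0 h1
  exact (h.smul (div_nonneg h.inv.trace_nonneg (by positivity))).inv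

/-! ### Distances inside proper arcs of a cycle -/

/-- The position of `t` on the cycle, counted from `g`. -/
def cyclePosition {m : ℕ} (g t : Fin m) : ℕ := if g < t then t - g else t + m - g

/-- Cutting the cycle at `g` leaves a path with positions `1, …, m - 1` in order. The cut point
itself has position `m`, which is why it is excluded. -/
theorem cycleGraph_adj_iff_cyclePosition {m : ℕ} (hm : 2 ≤ m) {g a b : Fin m} (ha : a ≠ g)
    (hb : b ≠ g) :
    (SimpleGraph.cycleGraph m).Adj a b ↔
      cyclePosition g a + 1 = cyclePosition g b ∨ cyclePosition g b + 1 = cyclePosition g a := by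
  have hs : ∀ u v : Fin m, (u - v).val = if v ≤ u then u.val - v.val else m - v.val + u.val := by
    intro u v
    split_ifs with h
    · exact Fin.sub_val_of_le h
    · rw [Fin.sub_def]
      simp only
      rw [Nat.mod_eq_of_lt]
      have := Fin.not_le.1 h
      omega
  rw [SimpleGraph.cycleGraph_adj', hs, hs]
  unfold cyclePosition
  rw [ne_eq, Fin.ext_iff] at ha hb
  simp only [Fin.le_def, Fin.lt_def]
  have := a.2
  have := b.2
  have := g.2
  split_ifs <;> omega

theorem exists_cyclePosition_eq {m : ℕ} (g : Fin m) {p : ℕ} (h1 : 1 ≤ p) (h2 : p ≤ m) :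
    ∃ t, cyclePosition g t = p := by
  have := g.2
  by_cases h : p + g < m
  · refine ⟨⟨p + g, h⟩, ?_⟩
    unfold cyclePosition
    simp only [Fin.lt_def]
    split_ifs <;> omega
  · refine ⟨⟨p + g - m, by omega⟩, ?_⟩
    unfold cyclePosition
    simp only [Fin.lt_def]
    split_ifs <;> omega

theorem cyclePosition_mem {m : ℕ} (g t : Fin m) :
    1 ≤ cyclePosition g t ∧ cyclePosition g t ≤ m := by
  unfold cyclePosition
  simp only [Fin.lt_def]
  split_ifs <;> omega

/-- In a cycle, an arc contains one of the two ways between any two of its points. -/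
def IsCyclicArc {m : ℕ} (A : Set (Fin m)) : Prop :=
  ∀ t₁ ∈ A, ∀ t₂ ∈ A, t₁ < t₂ → Set.Icc t₁ t₂ ⊆ A ∨ Set.Ici t₂ ∪ Set.Iic t₁ ⊆ A

/-- If each way from `t₁` to `t₂` missed a point, the two missed points would separate `t₁` from
`t₂` on the circle. The common point `t₀` would then be cut off from one of them, against the arc
property of `A` or `B`. -/
theorem IsCyclicArc.sUnion {m : ℕ} {t₀ : Fin m} {c : Set (Set (Fin m))}
    (h : ∀ A ∈ c, t₀ ∈ A ∧ IsCyclicArc A) : IsCyclicArc (⋃₀ c) := by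
  rintro t₁ ⟨A, hA, h1⟩ t₂ ⟨B, hB, h2⟩ hlt
  have hA' : A ⊆ ⋃₀ c := Set.subset_sUnion_of_mem hA
  have hB' : B ⊆ ⋃₀ c := Set.subset_sUnion_of_mem hB
  obtain ⟨hA0, hAarc⟩ := h A hA
  obtain ⟨hB0, hBarc⟩ := h B hB
  by_contra hcon
  push Not at hcon
  obtain ⟨hc1, hc2⟩ := hcon
  rw [Set.not_subset] at hc1 hc2
  obtain ⟨x, hx, hxn⟩ := hc1
  obtain ⟨y, hy, hyn⟩ := hc2
  have hxA := fun h => hxn (hA' h)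
  have hxB := fun h => hxn (hB' h)
  have hyA := fun h => hyn (hA' h)
  have hyB := fun h => hyn (hB' h)
  have a1 := hAarc t₁ h1 t₀ hA0
  have a2 := hAarc t₀ hA0 t₁ h1
  have b1 := hBarc t₂ h2 t₀ hB0
  have b2 := hBarc t₀ hB0 t₂ h2
  simp only [Set.subset_def, Set.mem_Icc, Set.mem_union, Set.mem_Ici, Set.mem_Iic] at *
  grind

/-- An arc that misses `g` cannot join `a` and `b` through `g`, so it contains the other way between
them. -/
theorem IsCyclicArc.mem_of_cyclePosition {m : ℕ} {A : Set (Fin m)} (hA : IsCyclicArc A)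
    {g : Fin m} (hg : g ∉ A) {a b t : Fin m} (ha : a ∈ A) (hb : b ∈ A)
    (h1 : cyclePosition g a ≤ cyclePosition g t) (h2 : cyclePosition g t ≤ cyclePosition g b) :
    t ∈ A := by
  by_contra ht
  have a1 := hA a ha b hb
  have a2 := hA b hb a ha
  have hag : a ≠ g := fun h => hg (h ▸ ha)
  have hbg : b ≠ g := fun h => hg (h ▸ hb)
  have hta : t ≠ a := fun h => ht (h ▸ ha)
  have htb : t ≠ b := fun h => ht (h ▸ hb)
  unfold cyclePosition at h1 h2
  rcases lt_trichotomy a b with hab | rfl | hab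
  · rcases a1 hab with h | h
    · have hgn : ¬ (g ∈ Set.Icc a b) := fun hh => hg (h hh)
      have htn : ¬ (t ∈ Set.Icc a b) := fun hh => ht (h hh)
      simp only [Set.mem_Icc, Fin.le_def, Fin.lt_def, ne_eq, Fin.ext_iff] at *
      split_ifs at h1 h2 <;> omega
    · have hgn : ¬ (g ∈ Set.Ici b ∪ Set.Iic a) := fun hh => hg (h hh)
      have htn : ¬ (t ∈ Set.Ici b ∪ Set.Iic a) := fun hh => ht (h hh)
      simp only [Set.mem_union, Set.mem_Ici, Set.mem_Iic, Fin.le_def, Fin.lt_def, ne_eq,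
        Fin.ext_iff] at *
      split_ifs at h1 h2 <;> omega
  · simp only [Fin.lt_def, ne_eq, Fin.ext_iff] at *
    split_ifs at h1 h2 <;> omega
  · rcases a2 hab with h | h
    · have hgn : ¬ (g ∈ Set.Icc b a) := fun hh => hg (h hh)
      have htn : ¬ (t ∈ Set.Icc b a) := fun hh => ht (h hh)
      simp only [Set.mem_Icc, Fin.le_def, Fin.lt_def, ne_eq, Fin.ext_iff] at *
      split_ifs at h1 h2 <;> omega
    · have hgn : ¬ (g ∈ Set.Ici a ∪ Set.Iic b) := fun hh => hg (h hh)
      have htn : ¬ (t ∈ Set.Ici a ∪ Set.Iic b) := fun hh => ht (h hh)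
      simp only [Set.mem_union, Set.mem_Ici, Set.mem_Iic, Fin.le_def, Fin.lt_def, ne_eq,
        Fin.ext_iff] at *
      split_ifs at h1 h2 <;> omega

/-- Each step of a walk changes the position by one, which bounds the distance below. The monotone
walk along positions stays inside the arc and attains the bound. -/
theorem IsCyclicArc.dist_eq {m : ℕ} (hm : 2 ≤ m) {A : Set (Fin m)} (hA : IsCyclicArc A)
    {g : Fin m} (hg : g ∉ A) {a b : Fin m} (ha : a ∈ A) (hb : b ∈ A) :
    ((SimpleGraph.cycleGraph m).induce A).spanningCoe.dist a b =
      Nat.dist (cyclePosition g a) (cyclePosition g b) := by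
  set H := ((SimpleGraph.cycleGraph m).induce A).spanningCoe with hH
  have hadj : ∀ x y, H.Adj x y ↔ x ∈ A ∧ y ∈ A ∧ (cyclePosition g x + 1 = cyclePosition g y ∨
      cyclePosition g y + 1 = cyclePosition g x) := by
    intro x y
    have : H.Adj x y ↔ x ∈ A ∧ y ∈ A ∧ (SimpleGraph.cycleGraph m).Adj x y := by
      simp [hH]
      tauto
    rw [this]
    refine and_congr_right fun hx => and_congr_right fun hy => ?_
    exact cycleGraph_adj_iff_cyclePosition hm (fun h => hg (h ▸ hx)) (fun h => hg (h ▸ hy))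
  have hlow : ∀ x y (p : H.Walk x y),
      Nat.dist (cyclePosition g x) (cyclePosition g y) ≤ p.length := by
    intro x y p
    induction p with
    | nil => simp
    | cons h p ih =>
      have := ((hadj _ _).1 h).2.2
      rw [SimpleGraph.Walk.length_cons]
      unfold Nat.dist at *
      omega
  have hup : ∀ (d : ℕ) (x y : Fin m), x ∈ A → y ∈ A → cyclePosition g x + d = cyclePosition g y →
      ∃ p : H.Walk x y, p.length = d := by
    intro d
    induction d with
    | zero =>
      intro x y hx hy h
      have hxy : x = y := by
        unfold cyclePosition at h
        rw [Fin.ext_iff]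
        simp only [Fin.lt_def] at h
        have := x.2
        have := y.2
        have := g.2
        split_ifs at h <;> omega
      subst hxy
      exact ⟨.nil, rfl⟩
    | succ d ih =>
      intro x y hx hy h
      have hx1 := cyclePosition_mem g x
      have hy1 := cyclePosition_mem g y
      obtain ⟨z, hz⟩ := exists_cyclePosition_eq g (p := cyclePosition g x + 1) (by omega) (by omega)
      have hzA : z ∈ A := hA.mem_of_cyclePosition hg hx hy (by omega) (by omega)
      obtain ⟨p, hp⟩ := ih z y hzA hy (by omega)
      exact ⟨.cons ((hadj x z).2 ⟨hx, hzA, Or.inl hz.symm⟩) p, by simp [hp]⟩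
  have hw : ∃ p : H.Walk a b, p.length = Nat.dist (cyclePosition g a) (cyclePosition g b) := by
    rcases le_total (cyclePosition g a) (cyclePosition g b) with h | h
    · exact hup _ a b ha hb (by unfold Nat.dist; omega)
    · obtain ⟨p, hp⟩ := hup (Nat.dist (cyclePosition g a) (cyclePosition g b)) b a hb ha
        (by unfold Nat.dist; omega)
      exact ⟨p.reverse, by simpa using hp⟩
  obtain ⟨p, hp⟩ := hw
  obtain ⟨p', hp'⟩ := SimpleGraph.Reachable.exists_walk_length_eq_dist ⟨p⟩
  refine le_antisymm (hp ▸ SimpleGraph.dist_le p) ?_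
  rw [← hp']
  exact hlow a b p'

/-- For a proper arc, cutting at a missed point turns the kernel into the autoregressive one on
positions. -/
theorem IsCyclicArc.isPosSemidefKernel_periodicTemporalKernel {m : ℕ} (hm : 3 ≤ m)
    {A : Set (Fin m)} (hA : IsCyclicArc A) {ρ lam : ℝ} (hρ0 : 0 ≤ ρ) (hρ1 : ρ < 1 / 2)
    (hl1 : -1 < lam) (hl2 : lam < 1) :
    IsPosSemidefKernel fun t₁ t₂ : A =>
      EquivalentSimpleGraph.periodicTemporalKernel m ρ lam A t₁ t₂ := by
  unfold EquivalentSimpleGraph.periodicTemporalKernel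
  by_cases h : A = Set.univ
  · simp only [if_pos h]
    exact fun n x => (posSemidef_inv_circulant hm hρ0 hρ1).submatrix fun i => (x i : Fin m)
  · simp only [if_neg h]
    obtain ⟨g, hg⟩ := (Set.ne_univ_iff_exists_notMem A).1 h
    have := (isPosSemidefKernel_pow_dist hl1 hl2).comp fun t : A => cyclePosition g (t : Fin m)
    convert this using 4 with t₁ t₂
    exact hA.dist_eq (by omega) hg t₁.2 t₂.2

namespace EquivalentSimpleGraph

/-! ### The Laplacian and its Moore–Penrose inverse -/

section

variable {m : ℕ} {V S : Type*} (G : EquivalentSimpleGraph m V S)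

theorem weight_symm (v w : V) : G.weight v w = G.weight w v := by
  unfold weight
  rw [G.spatial.adj_comm v w, G.temporal.adj_comm v w, G.spatialWeight_symm v w,
    G.temporalWeight_symm v w]

theorem weight_pos {v w : V} (h : G.graph.Adj v w) : 0 < G.weight v w := by
  unfold weight
  split_ifs with h1 h2
  · exact G.spatialWeight_pos v w h1
  · exact G.temporalWeight_pos v w h2
  · exact (h.elim h1 h2).elim

theorem weight_nonneg (v w : V) : 0 ≤ G.weight v w := by
  by_cases h : G.graph.Adj v w
  · exact (G.weight_pos h).le
  · have h' : ¬ (G.spatial.Adj v w ∨ G.temporal.Adj v w) := h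
    rw [not_or] at h'
    simp [weight, h'.1, h'.2]

theorem weight_self (v : V) : G.weight v v = 0 := by
  simp [weight]

variable [Fintype V]

theorem transpose_laplacian : G.laplacianᵀ = G.laplacian := by
  ext v w
  simp only [laplacian, Matrix.transpose_apply, Matrix.of_apply]
  by_cases h : v = w
  · subst h
    rfl
  · rw [if_neg h, if_neg (Ne.symm h), G.weight_symm]

theorem laplacian_mulVec (x : V → ℝ) (v : V) :
    (G.laplacian *ᵥ x) v = ∑ w, G.weight v w * (x v - x w) := by
  classical
  have h : ∀ w, G.laplacian v w * x w =
      (if v = w then (∑ u, G.weight v u) * x v else 0) - G.weight v w * x w := by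
    intro w
    simp only [laplacian, Matrix.of_apply]
    by_cases h : v = w
    · subst h
      simp [G.weight_self]
    · simp [h]
  simp only [Matrix.mulVec, dotProduct, h, Finset.sum_sub_distrib, mul_sub, Finset.sum_mul]
  simp

theorem two_mul_dotProduct_laplacian_mulVec (x : V → ℝ) :
    2 * (x ⬝ᵥ G.laplacian *ᵥ x) = ∑ v, ∑ w, G.weight v w * (x v - x w) ^ 2 := by
  have h1 : x ⬝ᵥ G.laplacian *ᵥ x = ∑ v, ∑ w, x v * (G.weight v w * (x v - x w)) := by
    simp only [dotProduct, G.laplacian_mulVec, Finset.mul_sum]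
  have h2 : x ⬝ᵥ G.laplacian *ᵥ x = ∑ v, ∑ w, x w * (G.weight v w * (x w - x v)) := by
    rw [h1, Finset.sum_comm]
    exact Finset.sum_congr rfl fun v _ => Finset.sum_congr rfl fun w _ => by rw [G.weight_symm]
  rw [two_mul]
  nth_rewrite 1 [h1]
  rw [h2, ← Finset.sum_add_distrib]
  refine Finset.sum_congr rfl fun v _ => ?_
  rw [← Finset.sum_add_distrib]
  exact Finset.sum_congr rfl fun w _ => by ring

theorem dotProduct_laplacian_mulVec_nonneg (x : V → ℝ) : 0 ≤ x ⬝ᵥ G.laplacian *ᵥ x := by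
  have := G.two_mul_dotProduct_laplacian_mulVec x
  have h : 0 ≤ ∑ v, ∑ w, G.weight v w * (x v - x w) ^ 2 :=
    Finset.sum_nonneg fun v _ => Finset.sum_nonneg fun w _ =>
      mul_nonneg (G.weight_nonneg v w) (sq_nonneg _)
  linarith

variable {G}

/-- Zero Dirichlet energy forces equality across each edge, and walks propagate it. -/
theorem eq_of_dotProduct_laplacian_mulVec_eq_zero (hG : G.graph.Connected) {x : V → ℝ}
    (h : x ⬝ᵥ G.laplacian *ᵥ x = 0) (v w : V) : x v = x w := by
  have h1 := G.two_mul_dotProduct_laplacian_mulVec x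
  have h0 : ∀ v w, 0 ≤ G.weight v w * (x v - x w) ^ 2 := fun v w =>
    mul_nonneg (G.weight_nonneg v w) (sq_nonneg _)
  rw [h, mul_zero, eq_comm, Finset.sum_eq_zero_iff_of_nonneg
    fun v _ => Finset.sum_nonneg fun w _ => h0 v w] at h1
  have hadj : ∀ v w, G.graph.Adj v w → x v = x w := by
    intro v w hvw
    have h2 := h1 v (Finset.mem_univ _)
    rw [Finset.sum_eq_zero_iff_of_nonneg fun w _ => h0 v w] at h2
    have h3 := (mul_eq_zero.1 (h2 w (Finset.mem_univ _))).resolve_left (G.weight_pos hvw).ne'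
    exact sub_eq_zero.1 (pow_eq_zero_iff two_ne_zero |>.1 h3)
  obtain ⟨p⟩ := hG.preconnected v w
  induction p with
  | nil => rfl
  | cons h p ih => exact (hadj _ _ h).trans ih

end

theorem _root_.transpose_moorePenrose {n : Type*} [Fintype n] {M : Matrix n n ℝ} (hM : Mᵀ = M) :
    (moorePenrose M)ᵀ = moorePenrose M := by
  have h := moorePenrose_spec M
  refine IsMoorePenrose.unique (M := M) ⟨?_, ?_, ?_, ?_⟩ h
  · simpa [Matrix.transpose_mul, hM, Matrix.mul_assoc] using congrArg Matrix.transpose h.left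
  · simpa [Matrix.transpose_mul, hM, Matrix.mul_assoc] using congrArg Matrix.transpose h.right
  · have := h.symm_right
    rw [Matrix.transpose_mul, hM] at this
    rw [this, ← this, Matrix.transpose_mul, Matrix.transpose_transpose, hM, this]
  · have := h.symm_left
    rw [Matrix.transpose_mul, hM] at this
    rw [this, ← this, Matrix.transpose_mul, Matrix.transpose_transpose, hM, this]

section

variable {m : ℕ} {V S : Type*} [Fintype V] (G : EquivalentSimpleGraph m V S)

/-- Transfers positivity from `L` to `L⁺` through `L⁺ L L⁺ = L⁺` and the symmetry of `L⁺`. -/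
theorem dotProduct_moorePenrose_mulVec (x : V → ℝ) :
    x ⬝ᵥ moorePenrose G.laplacian *ᵥ x =
      (moorePenrose G.laplacian *ᵥ x) ⬝ᵥ G.laplacian *ᵥ (moorePenrose G.laplacian *ᵥ x) := by
  set P := moorePenrose G.laplacian with hP
  have hPt : Pᵀ = P := transpose_moorePenrose G.transpose_laplacian
  have h := (moorePenrose_spec G.laplacian).right
  rw [← hP] at h
  nth_rewrite 1 [← h]
  rw [Matrix.mul_assoc, ← Matrix.mulVec_mulVec, Matrix.dotProduct_mulVec, ← Matrix.mulVec_transpose,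
    hPt, Matrix.mulVec_mulVec]

theorem posSemidef_moorePenrose_laplacian : (moorePenrose G.laplacian).PosSemidef := by
  refine .of_dotProduct_mulVec_nonneg ?_ fun x => ?_
  · rw [Matrix.IsHermitian, Matrix.conjTranspose_eq_transpose_of_trivial]
    exact transpose_moorePenrose G.transpose_laplacian
  · rw [star_trivial, G.dotProduct_moorePenrose_mulVec]
    exact G.dotProduct_laplacian_mulVec_nonneg _

variable {G}

/-- The energy of `L⁺ x` vanishes, so `L L⁺ x = 0`. As `L` and `L⁺` commute, `L x = L L⁺ L x = 0`,
and `x` is a constant of sum zero. -/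
theorem eq_zero_of_dotProduct_moorePenrose_mulVec_eq_zero (hG : G.graph.Connected) {x : V → ℝ}
    (hsum : ∑ v, x v = 0) (h : x ⬝ᵥ moorePenrose G.laplacian *ᵥ x = 0) : x = 0 := by
  set P := moorePenrose G.laplacian with hP
  have hPt : Pᵀ = P := transpose_moorePenrose G.transpose_laplacian
  have hspec := moorePenrose_spec G.laplacian
  rw [← hP] at hspec
  have h1 : G.laplacian *ᵥ (P *ᵥ x) = 0 := by
    rw [G.dotProduct_moorePenrose_mulVec] at h
    have hc := eq_of_dotProduct_laplacian_mulVec_eq_zero hG h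
    funext v
    rw [G.laplacian_mulVec]
    exact Finset.sum_eq_zero fun w _ => by rw [hc v w, sub_self, mul_zero]
  have hcomm : G.laplacian * P = P * G.laplacian := by
    rw [← hspec.symm_left, Matrix.transpose_mul, hPt, G.transpose_laplacian]
  have h2 : G.laplacian *ᵥ x = 0 := by
    rw [← hspec.left, Matrix.mul_assoc, ← hcomm, ← Matrix.mulVec_mulVec, ← Matrix.mulVec_mulVec, h1,
      Matrix.mulVec_zero]
  have hc := eq_of_dotProduct_laplacian_mulVec_eq_zero hG (x := x) (by rw [h2, dotProduct_zero])
  funext v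
  have h3 : ∑ w, x w = Fintype.card V * x v := by
    rw [Finset.sum_congr rfl fun w _ => hc w v]
    simp
  have h4 : (Fintype.card V : ℝ) ≠ 0 := by
    have : Nonempty V := ⟨v⟩
    exact_mod_cast Fintype.card_ne_zero
  rw [hsum] at h3
  exact (mul_eq_zero.1 h3.symm).resolve_left h4

end

/-! ### The covariance function of the vertex process -/

section

variable {m : ℕ} {V S : Type*} [LinearOrder V] {G : EquivalentSimpleGraph m V S}

/-- The barycentric coordinates of a point of the graph. -/
def Point.coord (u : G.Point) (v : V) : ℝ :=
  (if v = u.lo then 1 - u.delta else 0) + (if v = u.hi then u.delta else 0)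

/-- The support of the coordinates is the vertex or the pair of endpoints. The convention `lo < hi`
decides which endpoint carries `δ`. -/
theorem Point.coord_injective : Function.Injective (Point.coord : G.Point → V → ℝ) := by
  intro u₁ u₂ h
  rcases u₁ with v | ⟨e, δ⟩ <;> rcases u₂ with w | ⟨f, ε⟩
  · have := congrFun h v
    simp only [Point.coord, Point.lo, Point.hi, Point.delta] at this
    by_cases hvw : v = w
    · rw [hvw]
    · simp [hvw] at this
  · obtain ⟨ε, hε0, hε1⟩ := ε
    have h1 := congrFun h f.lo
    have h2 := congrFun h f.hi
    have hlt := f.lt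
    simp only [Point.coord, Point.lo, Point.hi, Point.delta, hlt.ne, hlt.ne', if_true, if_false]
      at h1 h2
    split_ifs at h1 h2 <;> grind
  · obtain ⟨δ, hδ0, hδ1⟩ := δ
    have h1 := congrFun h e.lo
    have h2 := congrFun h e.hi
    have hlt := e.lt
    simp only [Point.coord, Point.lo, Point.hi, Point.delta, hlt.ne, hlt.ne', if_true, if_false]
      at h1 h2
    split_ifs at h1 h2 <;> grind
  · obtain ⟨δ, hδ0, hδ1⟩ := δ
    obtain ⟨ε, hε0, hε1⟩ := ε
    have h1 := congrFun h e.lo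
    have h2 := congrFun h e.hi
    have helt := e.lt
    have hflt := f.lt
    simp only [Point.coord, Point.lo, Point.hi, Point.delta, helt.ne, helt.ne', if_true, if_false]
      at h1 h2
    have hlo : e.lo = f.lo := by
      by_contra hlo
      have h3 : e.lo = f.hi := by
        by_contra h3
        simp only [hlo, h3, if_false] at h1
        linarith
      have h4 : e.hi = f.lo := by
        by_contra h4
        have h5 : e.hi ≠ f.hi := fun h5 => helt.ne (h3.trans h5.symm)
        simp only [h4, h5, if_false] at h2
        linarith
      rw [h3, h4] at helt
      exact lt_asymm helt hflt
    have hhi : e.hi = f.hi := by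
      by_contra hhi
      have h4 : e.hi ≠ f.lo := fun h4 => helt.ne (hlo.trans h4.symm)
      simp only [h4, hhi, if_false] at h2
      linarith
    have hef : e = f := Edge.ext hlo hhi
    subst hef
    simp only [helt.ne', if_true, if_false] at h2
    have : δ = ε := by linarith
    subst this
    rfl

variable [Fintype V]

theorem Point.sum_coord (u : G.Point) : ∑ v, u.coord v = 1 := by
  simp [Point.coord, Finset.sum_add_distrib]

theorem kernelV_eq (u₁ u₂ : G.Point) :
    G.kernelV u₁ u₂ = u₁.coord ⬝ᵥ moorePenrose G.laplacian *ᵥ u₂.coord := by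
  have h : ∀ f : V → ℝ, ∀ u : G.Point, ∑ v, u.coord v * f v =
      (1 - u.delta) * f u.lo + u.delta * f u.hi := by
    intro f u
    simp [Point.coord, add_mul, Finset.sum_add_distrib]
  have h' : ∀ v, (moorePenrose G.laplacian *ᵥ u₂.coord) v =
      (1 - u₂.delta) * moorePenrose G.laplacian v u₂.lo +
        u₂.delta * moorePenrose G.laplacian v u₂.hi := by
    intro v
    rw [← h, Matrix.mulVec, dotProduct_comm]
    rfl
  rw [dotProduct, h, h', h', kernelV]
  ring

theorem isPosSemidefKernel_kernelV : IsPosSemidefKernel G.kernelV := by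
  intro n x
  have := G.posSemidef_moorePenrose_laplacian.conjTranspose_mul_mul_same
    (Matrix.of fun (v : V) (i : Fin n) => (x i).coord v)
  convert this using 1
  ext i j
  rw [Matrix.of_apply, kernelV_eq, Matrix.mul_assoc]
  rfl

theorem kernelV_dist_eq (u₁ u₂ : G.Point) :
    G.kernelV u₁ u₁ + G.kernelV u₂ u₂ - 2 * G.kernelV u₁ u₂ =
      (u₁.coord - u₂.coord) ⬝ᵥ moorePenrose G.laplacian *ᵥ (u₁.coord - u₂.coord) := by
  have hs := isPosSemidefKernel_kernelV.symm u₂ u₁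
  simp only [kernelV_eq, Matrix.mulVec_sub, dotProduct_sub, sub_dotProduct] at hs ⊢
  linarith

/-- Coordinates sum to one, so their difference has sum zero, where `L⁺` is definite. -/
theorem eq_of_kernelV_dist_eq_zero (hG : G.graph.Connected) {u₁ u₂ : G.Point}
    (h : G.kernelV u₁ u₁ + G.kernelV u₂ u₂ - 2 * G.kernelV u₁ u₂ = 0) : u₁ = u₂ := by
  rw [kernelV_dist_eq] at h
  have := eq_zero_of_dotProduct_moorePenrose_mulVec_eq_zero hG (by simp [Point.sum_coord]) h
  exact Point.coord_injective (sub_eq_zero.1 this)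

end

/-! ### Lifespans, lives and the covariance function of the edge process -/

section

variable {m : ℕ} {V S : Type*} [LinearOrder V] {G : EquivalentSimpleGraph m V S}

theorem Edge.length_pos (e : G.Edge) : 0 < e.length := inv_pos.2 (G.weight_pos e.adj)

theorem Edge.IsSpatial.represents_self {e : G.Edge} (he : e.IsSpatial) :
    e.Represents e (G.time e.lo) :=
  ⟨he, rfl, rfl, rfl, (G.spatial_time _ _ he).symm⟩

/-- The properties common to the notions of lifespan: the lifespan of a spatial edge contains the
time of the edge and consists of times at which the edge exists. -/
structure IsLifespan (ls : G.Edge → Set (Fin m)) : Prop where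
  time_mem : ∀ e : G.Edge, e.IsSpatial → G.time e.lo ∈ ls e
  exists_represents : ∀ e : G.Edge, ∀ t ∈ ls e, ∃ e' : G.Edge, e'.Represents e t

theorem isLifespan_linearLifespan : IsLifespan (linearLifespan (G := G)) where
  time_mem e he := ⟨{G.time e.lo}, ⟨rfl, fun t₁ h₁ t₂ h₂ h => by
    rw [Set.mem_singleton_iff] at h₁ h₂
    exact absurd h (by rw [h₁, h₂]; exact lt_irrefl _),
    fun t ht => ⟨e, by rw [Set.mem_singleton_iff.1 ht]; exact he.represents_self⟩⟩, rfl⟩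
  exists_represents := by
    rintro e t ⟨A, ⟨-, -, h⟩, ht⟩
    exact h t ht

theorem isLifespan_periodicLifespan : IsLifespan (periodicLifespan (G := G)) where
  time_mem e he := ⟨{G.time e.lo}, ⟨rfl, fun t₁ h₁ t₂ h₂ h => by
    rw [Set.mem_singleton_iff] at h₁ h₂
    exact absurd h (by rw [h₁, h₂]; exact lt_irrefl _),
    fun t ht => ⟨e, by rw [Set.mem_singleton_iff.1 ht]; exact he.represents_self⟩⟩, rfl⟩
  exists_represents := by
    rintro e t ⟨A, ⟨-, -, h⟩, ht⟩
    exact h t ht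

/-- All admissible arcs share the time of `e`, so their union is again an arc. -/
theorem isCyclicArc_periodicLifespan (e : G.Edge) : IsCyclicArc (periodicLifespan e) :=
  IsCyclicArc.sUnion (t₀ := G.time e.lo) fun _ hA => ⟨hA.1, hA.2.1⟩

namespace IsLifespan

variable {ls : G.Edge → Set (Fin m)}

theorem mem_life_self (hls : IsLifespan ls) (e : G.Edge) : e ∈ life ls e := by
  unfold life
  split_ifs with he
  · exact ⟨_, hls.time_mem e he, he.represents_self⟩
  · rfl

theorem isSpatial_iff (hls : IsLifespan ls) {e₁ e₂ : G.Edge} (h : life ls e₁ = life ls e₂) :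
    e₁.IsSpatial ↔ e₂.IsSpatial := by
  have key : ∀ {e₁ e₂ : G.Edge}, life ls e₁ = life ls e₂ → e₂.IsSpatial → e₁.IsSpatial := by
    intro e₁ e₂ h h₂
    have := hls.mem_life_self e₁
    rw [h, life, if_pos h₂] at this
    obtain ⟨t, -, ht⟩ := this
    exact ht.1
  exact ⟨key h.symm, key h⟩

theorem time_mem_of_life_eq (hls : IsLifespan ls) {e₁ e₂ : G.Edge} (h : life ls e₁ = life ls e₂)
    (h₂ : e₂.IsSpatial) :
    G.time e₁.lo ∈ ls e₂ := by
  have := hls.mem_life_self e₁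
  rw [h, life, if_pos h₂] at this
  obtain ⟨t, ht, hr⟩ := this
  rw [hr.2.2.2.1]
  exact ht

/-- The lifespan can be read off the life as the set of times of its members. Hence a temporal
kernel chosen through the lifespan is the same for all edges of a life. -/
theorem lifespan_eq_of_life_eq (hls : IsLifespan ls) {e₁ e₂ : G.Edge} (h : life ls e₁ = life ls e₂)
    (h₁ : e₁.IsSpatial) : ls e₁ = ls e₂ := by
  have key : ∀ {e₁ e₂ : G.Edge}, life ls e₁ = life ls e₂ → e₁.IsSpatial → e₂.IsSpatial →
      ls e₁ ⊆ ls e₂ := by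
    intro e₁ e₂ h h₁ h₂ t ht
    obtain ⟨e', he'⟩ := hls.exists_represents e₁ t ht
    have : e' ∈ life ls e₁ := by
      rw [life, if_pos h₁]
      exact ⟨t, ht, he'⟩
    rw [h, life, if_pos h₂] at this
    obtain ⟨t', ht', hr⟩ := this
    rw [← he'.2.2.2.1, hr.2.2.2.1]
    exact ht'
  have h₂ := (hls.isSpatial_iff h).1 h₁
  exact (key h h₁ h₂).antisymm (key h.symm h₂ h₁)

/-- The kernel is block diagonal over lives. On one life it is the Schur product of the rank-one
kernel of `√ℓ`, the temporal kernel and the bridge kernel. -/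
theorem isPosSemidefKernel_kernelE (hls : IsLifespan ls) {K : G.Edge → Fin m → Fin m → ℝ}
    (hK : ∀ e₁ e₂ : G.Edge, life ls e₁ = life ls e₂ → e₁.IsSpatial → K e₁ = K e₂)
    (hpos : ∀ e : G.Edge, e.IsSpatial → IsPosSemidefKernel fun t₁ t₂ : ls e => K e t₁ t₂) :
    IsPosSemidefKernel (G.kernelE ls K) := by
  classical
  let q : G.Point → Option (Set G.Edge) := fun u => match u with
    | .vertex _ => none
    | .inner e _ => some (life ls e)
  refine IsPosSemidefKernel.of_fibers q ?_ ?_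
  · rintro (v | ⟨e, δ⟩) (w | ⟨f, ε⟩) h
    · rfl
    · rfl
    · rfl
    · have hne : life ls e ≠ life ls f := fun h' => h (congrArg some h')
      simp [kernelE, hne]
  · rintro (_ | a)
    · have h0 : ∀ x y : {x // q x = none}, G.kernelE ls K x y = 0 := by
        rintro ⟨v | ⟨e, δ⟩, hx⟩ y
        · rfl
        · cases hx
      simp only [h0]
      exact IsPosSemidefKernel.const le_rfl
    · have hex : ∀ x : {x // q x = some a}, ∃ (e : G.Edge) (δ : Set.Ioo (0 : ℝ) 1),
          x.1 = .inner e δ ∧ life ls e = a := by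
        rintro ⟨v | ⟨e, δ⟩, hx⟩
        · cases hx
        · exact ⟨e, δ, rfl, Option.some_injective _ hx⟩
      choose e δ hx ha using hex
      have hT : IsPosSemidefKernel fun x y : {x // q x = some a} =>
          if (e x).IsSpatial then K (e x) (G.time (e x).lo) (G.time (e y).lo) else 1 := by
        -- A base edge `x₀` is needed so that all times of the block lie in one lifespan.
        rcases isEmpty_or_nonempty {x // q x = some a} with hE | ⟨⟨x₀⟩⟩
        · exact IsPosSemidefKernel.of_sum_nonneg (fun x => hE.elim x) fun n x c => by
            rcases n with _ | n
            · simp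
            · exact hE.elim (x 0)
        · have hsp : ∀ x, (e x).IsSpatial ↔ (e x₀).IsSpatial := fun x =>
            hls.isSpatial_iff ((ha x).trans (ha x₀).symm)
          by_cases h₀ : (e x₀).IsSpatial
          · have hc := (hpos (e x₀) h₀).comp fun x : {x // q x = some a} =>
              (⟨G.time (e x).lo, hls.time_mem_of_life_eq ((ha x).trans (ha x₀).symm) h₀⟩ :
                ls (e x₀))
            convert hc using 3 with x y
            rw [if_pos ((hsp x).2 h₀), hK _ _ ((ha x).trans (ha x₀).symm) ((hsp x).2 h₀)]
          · simp only [hsp, if_neg h₀]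
            exact IsPosSemidefKernel.const zero_le_one
      have hfull := ((IsPosSemidefKernel.rankOne fun x => √(e x).length).mul hT).mul
        (isPosSemidefKernel_bridgeKernel.comp δ)
      convert hfull using 3 with x y
      rw [hx x, hx y, kernelE, if_pos ((ha x).trans (ha y).symm),
        Real.sqrt_mul (e x).length_pos.le]

end IsLifespan

/-! ### Positivity and separation for the full kernels -/

variable [Fintype V]

theorem isPosSemidefKernel_linearKernel {kT : ℕ → ℝ}
    (hkT : IsPosSemidefKernel fun t₁ t₂ : Fin m => kT (Nat.dist t₁ t₂)) :
    IsPosSemidefKernel (G.linearKernel kT) :=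
  isPosSemidefKernel_kernelV.add <| isLifespan_linearLifespan.isPosSemidefKernel_kernelE
    (fun _ _ _ _ => rfl) fun _ _ => hkT.comp Subtype.val

theorem isPosSemidefKernel_periodicKernel (hm : 3 ≤ m) {ρ lam : ℝ} (hρ0 : 0 ≤ ρ) (hρ1 : ρ < 1 / 2)
    (hl1 : -1 < lam) (hl2 : lam < 1) (β : ℝ) :
    IsPosSemidefKernel (G.periodicKernel ρ lam β) := by
  have hE : IsPosSemidefKernel (G.kernelE periodicLifespan
      fun e => periodicTemporalKernel m ρ lam (periodicLifespan e)) :=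
    isLifespan_periodicLifespan.isPosSemidefKernel_kernelE
      (fun e₁ e₂ h h₁ => by rw [isLifespan_periodicLifespan.lifespan_eq_of_life_eq h h₁])
      fun e _ => (isCyclicArc_periodicLifespan e).isPosSemidefKernel_periodicTemporalKernel hm
        hρ0 hρ1 hl1 hl2
  exact ((isPosSemidefKernel_kernelV.comp fun p : G.PeriodicPoint => p.1.2).add
    (hE.comp fun p : G.PeriodicPoint => p.1.2)).add
    ((IsPosSemidefKernel.const (sq_nonneg β)).mul
      (isPosSemidefKernel_min.comp fun p : G.PeriodicPoint => p.1.1))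

theorem linearDist_ne_zero (hG : G.graph.Connected) {kT : ℕ → ℝ}
    (hkT : IsPosSemidefKernel fun t₁ t₂ : Fin m => kT (Nat.dist t₁ t₂)) {u₁ u₂ : G.Point}
    (hne : u₁ ≠ u₂) : G.linearDist kT u₁ u₂ ≠ 0 := by
  intro h
  refine hne (eq_of_kernelV_dist_eq_zero hG (le_antisymm ?_
    (isPosSemidefKernel_kernelV.dist_nonneg _ _)))
  have hE := (isLifespan_linearLifespan.isPosSemidefKernel_kernelE
    (K := fun _ t₁ t₂ => kT (Nat.dist t₁ t₂))
    (fun _ _ _ _ => rfl) fun _ _ => hkT.comp Subtype.val).dist_nonneg u₁ u₂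
  simp only [linearDist, linearKernel] at h
  linarith

/-- The distance is a sum of three nonnegative parts. The vertex part determines the point of the
graph, and `β ^ 2 * |t₁ - t₂|` determines the true time. -/
theorem periodicDist_ne_zero (hG : G.graph.Connected) (hm : 3 ≤ m) {ρ lam β : ℝ} (hρ0 : 0 ≤ ρ)
    (hρ1 : ρ < 1 / 2) (hl1 : -1 < lam) (hl2 : lam < 1) (hβ : 0 < β) {p₁ p₂ : G.PeriodicPoint}
    (hne : p₁ ≠ p₂) : G.periodicDist ρ lam β p₁ p₂ ≠ 0 := by
  intro h
  have hV := (isPosSemidefKernel_kernelV (G := G)).dist_nonneg p₁.1.2 p₂.1.2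
  have hE := (isLifespan_periodicLifespan.isPosSemidefKernel_kernelE
    (K := fun e => periodicTemporalKernel m ρ lam (periodicLifespan e))
    (fun e₁ e₂ h h₁ => by rw [isLifespan_periodicLifespan.lifespan_eq_of_life_eq h h₁])
    fun e _ => (isCyclicArc_periodicLifespan e).isPosSemidefKernel_periodicTemporalKernel hm
      hρ0 hρ1 hl1 hl2).dist_nonneg p₁.1.2 p₂.1.2
  have hW : (p₁.1.1 : ℝ) + p₂.1.1 - 2 * min (p₁.1.1 : ℝ) p₂.1.1 = |(p₁.1.1 : ℝ) - p₂.1.1| := by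
    rcases le_total (p₁.1.1 : ℝ) p₂.1.1 with h | h
    · rw [min_eq_left h, abs_of_nonpos (by linarith)]
      ring
    · rw [min_eq_right h, abs_of_nonneg (by linarith)]
      ring
  have hW0 : 0 ≤ β ^ 2 * |(p₁.1.1 : ℝ) - p₂.1.1| := by positivity
  simp only [periodicDist, periodicKernel, min_self] at h
  have hu : p₁.1.2 = p₂.1.2 :=
    eq_of_kernelV_dist_eq_zero hG (le_antisymm (by nlinarith) hV)
  have ht : p₁.1.1 = p₂.1.1 := by
    have h0 : β ^ 2 * |(p₁.1.1 : ℝ) - p₂.1.1| = 0 := le_antisymm (by nlinarith) hW0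
    have h1 := (mul_eq_zero.1 h0).resolve_left (by positivity)
    exact NNReal.coe_injective (sub_eq_zero.1 (abs_eq_zero.1 h1))
  exact hne (Subtype.ext (Prod.ext ht hu))

end

end EquivalentSimpleGraph

/-! ### The covariance functions of the constructed processes -/

namespace EquivalentSimpleGraph

namespace IsConstruction

variable {m : ℕ} {V S : Type*} [LinearOrder V] [Fintype V] {G : EquivalentSimpleGraph m V S}
  {ls : G.Edge → Set (Fin m)} {K : G.Edge → Fin m → Fin m → ℝ} {Ω : Type*} [MeasurableSpace Ω]
  {P : Measure Ω} {ZV ZE : G.Point → Ω → ℝ}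

theorem memLp_vertex (h : G.IsConstruction ls K P ZV ZE) (v : V) : MemLp (ZV (.vertex v)) 2 P := by
  have h1 := h.law_vertex.hasGaussianLaw.map_fun (EuclideanSpace.proj (𝕜 := ℝ) v)
  exact h1.memLp_two

theorem covariance_vertex (h : G.IsConstruction ls K P ZV ZE) (v w : V) :
    cov[ZV (.vertex v), ZV (.vertex w); P] = moorePenrose G.laplacian v w := by
  have h1 := h.law_vertex.covariance_fun_comp (f := fun x => x v) (g := fun x => x w)
    (Measurable.aemeasurable (by fun_prop)) (Measurable.aemeasurable (by fun_prop))
  rw [covariance_eval_multivariateGaussian G.posSemidef_moorePenrose_laplacian] at h1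
  exact h1

theorem vertexField_eq (h : G.IsConstruction ls K P ZV ZE) (u : G.Point) :
    ZV u = fun ω => (1 - u.delta) * ZV (.vertex u.lo) ω + u.delta * ZV (.vertex u.hi) ω := by
  funext ω
  rcases u with v | ⟨e, δ⟩
  · simp [Point.lo, Point.hi, Point.delta]
  · exact h.interpolation e δ ω

theorem memLp_vertexField (h : G.IsConstruction ls K P ZV ZE) (u : G.Point) :
    MemLp (ZV u) 2 P := by
  rw [h.vertexField_eq u]
  exact ((h.memLp_vertex _).const_mul _).add ((h.memLp_vertex _).const_mul _)

theorem covariance_vertexField [IsFiniteMeasure P] (h : G.IsConstruction ls K P ZV ZE)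
    (u₁ u₂ : G.Point) : cov[ZV u₁, ZV u₂; P] = G.kernelV u₁ u₂ := by
  have hm : ∀ (c : ℝ) (v : V), MemLp (c • ZV (.vertex v)) 2 P := fun c v =>
    (h.memLp_vertex v).const_smul c
  have e : ∀ u : G.Point, ZV u =
      (1 - u.delta) • ZV (.vertex u.lo) + u.delta • ZV (.vertex u.hi) := h.vertexField_eq
  rw [e u₁, e u₂, covariance_add_left (hm _ _) (hm _ _) ((hm _ _).add (hm _ _)),
    covariance_add_right (hm _ _) (hm _ _) (hm _ _),
    covariance_add_right (hm _ _) (hm _ _) (hm _ _)]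
  simp only [covariance_smul_left, covariance_smul_right, h.covariance_vertex, kernelV]
  ring

theorem memLp_edgeField [IsFiniteMeasure P] (hls : IsLifespan ls)
    (h : G.IsConstruction ls K P ZV ZE) (u : G.Point) : MemLp (ZE u) 2 P := by
  rcases u with v | ⟨e, δ⟩
  · rw [show ZE (.vertex v) = 0 from funext (h.vertex_zero v)]
    exact MemLp.zero
  · by_cases he : e.IsSpatial
    · obtain ⟨B, hB, -, -, hZ⟩ := h.spatial_edge e he
      rw [show ZE (.inner e δ) = fun ω => √e.length * B (G.time e.lo) δ ω from
        funext (hZ e (hls.mem_life_self e) δ)]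
      exact (hB.hasGaussianLaw_eval
        (⟨G.time e.lo, hls.time_mem e he⟩, ⟨δ, Set.Ioo_subset_Icc_self δ.2⟩)).memLp_two.const_mul _
    · exact ((h.temporal_edge e he).1.hasGaussianLaw_eval δ).memLp_two

theorem covariance_edgeField [IsFiniteMeasure P] (hls : IsLifespan ls)
    (h : G.IsConstruction ls K P ZV ZE) (u₁ u₂ : G.Point) :
    cov[ZE u₁, ZE u₂; P] = G.kernelE ls K u₁ u₂ := by
  have h0 : ∀ v, ZE (.vertex v) = 0 := fun v => funext (h.vertex_zero v)
  rcases u₁ with v | ⟨e₁, δ₁⟩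
  · rw [h0, covariance_zero_left]
    rfl
  rcases u₂ with v | ⟨e₂, δ₂⟩
  · rw [h0, covariance_zero_right]
    rfl
  simp only [kernelE]
  split_ifs with hlife hsp
  · obtain ⟨B, -, -, hcov, hZ⟩ := h.spatial_edge e₁ hsp
    rw [show ZE (.inner e₁ δ₁) = fun ω => √e₁.length * B (G.time e₁.lo) δ₁ ω from
        funext (hZ e₁ (hls.mem_life_self e₁) δ₁),
      show ZE (.inner e₂ δ₂) = fun ω => √e₂.length * B (G.time e₂.lo) δ₂ ω from
        funext (hZ e₂ (hlife ▸ hls.mem_life_self e₂) δ₂),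
      covariance_const_mul_left, covariance_const_mul_right,
      hcov _ (hls.time_mem e₁ hsp) _ (hls.time_mem_of_life_eq hlife.symm hsp) _
        (Set.Ioo_subset_Icc_self δ₁.2) _ (Set.Ioo_subset_Icc_self δ₂.2),
      Real.sqrt_mul e₁.length_pos.le]
    ring
  -- The life of a temporal edge is a singleton, so equal lives mean equal edges.
  · have he : e₁ = e₂ := by
      have h2 : ¬ e₂.IsSpatial := fun h2 => hsp ((hls.isSpatial_iff hlife).2 h2)
      rw [life, life, if_neg hsp, if_neg h2] at hlife
      exact Set.singleton_injective hlife
    subst he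
    rw [(h.temporal_edge e₁ hsp).2.2, Real.sqrt_mul_self e₁.length_pos.le, mul_one]
  · have hne : (⟨life ls e₁, e₁, rfl⟩ : Set.range (life ls)) ≠ ⟨life ls e₂, e₂, rfl⟩ :=
      fun h' => hlife (congrArg Subtype.val h')
    have hind : IndepFun (ZE (.inner e₁ δ₁)) (ZE (.inner e₂ δ₂)) P :=
      (h.indep_lives.indepFun hne).comp
        (φ := fun x : {e : G.Edge // life ls e = life ls e₁} × Set.Ioo (0 : ℝ) 1 → ℝ =>
          x (⟨e₁, rfl⟩, δ₁))
        (ψ := fun x : {e : G.Edge // life ls e = life ls e₂} × Set.Ioo (0 : ℝ) 1 → ℝ =>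
          x (⟨e₂, rfl⟩, δ₂))
        (measurable_pi_apply _) (measurable_pi_apply _)
    exact hind.covariance_eq_zero (h.memLp_edgeField hls _) (h.memLp_edgeField hls _)

theorem memLp_add [IsFiniteMeasure P] (hls : IsLifespan ls) (h : G.IsConstruction ls K P ZV ZE)
    (u : G.Point) : MemLp (ZV u + ZE u) 2 P :=
  (h.memLp_vertexField u).add (h.memLp_edgeField hls u)

theorem covariance_add [IsFiniteMeasure P] (hls : IsLifespan ls)
    (h : G.IsConstruction ls K P ZV ZE) (u₁ u₂ : G.Point) :
    cov[ZV u₁ + ZE u₁, ZV u₂ + ZE u₂; P] = G.kernelV u₁ u₂ + G.kernelE ls K u₁ u₂ := by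
  have hV := h.memLp_vertexField
  have hE := h.memLp_edgeField hls
  have hVE : ∀ u w, cov[ZV u, ZE w; P] = 0 := fun u w => by
    have hind : IndepFun (ZV u) (ZE w) P :=
      h.indep.comp (φ := fun x : G.Point → ℝ => x u) (ψ := fun x : G.Point → ℝ => x w)
        (measurable_pi_apply _) (measurable_pi_apply _)
    exact hind.covariance_eq_zero (hV u) (hE w)
  rw [covariance_add_left (hV _) (hE _) ((hV _).add (hE _)),
    covariance_add_right (hV _) (hV _) (hE _), covariance_add_right (hE _) (hV _) (hE _),
    covariance_comm (ZE u₁) (ZV u₂), hVE, hVE, h.covariance_vertexField,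
    h.covariance_edgeField hls]
  ring

end IsConstruction

/-! ### Variances of the increments of the full processes -/

theorem _root_.ProbabilityTheory.variance_sub_eq_covariance {Ω : Type*} [MeasurableSpace Ω]
    {P : Measure Ω} [IsFiniteMeasure P] {X Y : Ω → ℝ} (hX : MemLp X 2 P) (hY : MemLp Y 2 P) :
    Var[X - Y; P] = cov[X, X; P] + cov[Y, Y; P] - 2 * cov[X, Y; P] := by
  rw [variance_sub hX hY, covariance_self hX.aemeasurable, covariance_self hY.aemeasurable]
  ring

section

variable {m : ℕ} {V S : Type*} [LinearOrder V] [Fintype V] {G : EquivalentSimpleGraph m V S}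
  {Ω : Type*} [MeasurableSpace Ω] {P : Measure Ω} [IsFiniteMeasure P] {ZV ZE : G.Point → Ω → ℝ}

theorem IsLinearConstruction.variance_sub {kT : ℕ → ℝ} (h : G.IsLinearConstruction kT P ZV ZE)
    (u₁ u₂ : G.Point) :
    Var[fun ω => (ZV u₁ ω + ZE u₁ ω) - (ZV u₂ ω + ZE u₂ ω); P] = G.linearDist kT u₁ u₂ := by
  have h' : G.IsConstruction linearLifespan (fun _ t₁ t₂ => kT (Nat.dist t₁ t₂)) P ZV ZE := h
  have hls := isLifespan_linearLifespan (G := G)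
  have := variance_sub_eq_covariance (h'.memLp_add hls u₁) (h'.memLp_add hls u₂)
  simp only [h'.covariance_add hls] at this
  exact this

theorem IsPeriodicConstruction.variance_sub {ρ lam : ℝ} {W : ℝ≥0 → Ω → ℝ}
    (h : G.IsPeriodicConstruction ρ lam P ZV ZE W) (β : ℝ) (p₁ p₂ : G.PeriodicPoint) :
    Var[fun ω => (ZV p₁.1.2 ω + ZE p₁.1.2 ω + β * W p₁.1.1 ω)
        - (ZV p₂.1.2 ω + ZE p₂.1.2 ω + β * W p₂.1.1 ω); P] = G.periodicDist ρ lam β p₁ p₂ := by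
  obtain ⟨h', hW, hind⟩ := h
  have hls := isLifespan_periodicLifespan (G := G)
  have hWm : ∀ t, MemLp (β • W t) 2 P := fun t =>
    (hW.isGaussianProcess.hasGaussianLaw_eval t).memLp_two.const_smul β
  have hZ := h'.memLp_add hls
  have hZW : ∀ u t, cov[ZV u + ZE u, β • W t; P] = 0 := fun u t => by
    have hi : IndepFun (ZV u + ZE u) (β • W t) P :=
      hind.comp (φ := fun x : (G.Point → ℝ) × (G.Point → ℝ) => x.1 u + x.2 u)
        (ψ := fun x : ℝ≥0 → ℝ => β • x t) (by fun_prop) (by fun_prop)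
    exact hi.covariance_eq_zero (hZ u) (hWm t)
  have hcov : ∀ p q : G.PeriodicPoint,
      cov[ZV p.1.2 + ZE p.1.2 + β • W p.1.1, ZV q.1.2 + ZE q.1.2 + β • W q.1.1; P] =
        G.periodicKernel ρ lam β p q := by
    intro p q
    rw [covariance_add_left (hZ _) (hWm _) ((hZ _).add (hWm _)),
      covariance_add_right (hZ _) (hZ _) (hWm _), covariance_add_right (hWm _) (hZ _) (hWm _),
      covariance_comm (β • W p.1.1) (ZV q.1.2 + ZE q.1.2), hZW, hZW, h'.covariance_add hls,
      covariance_smul_left, covariance_smul_right, hW.covariance_eval, periodicKernel]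
    push_cast
    ring
  have := variance_sub_eq_covariance ((hZ p₁.1.2).add (hWm p₁.1.1)) ((hZ p₂.1.2).add (hWm p₂.1.1))
  simp only [hcov] at this
  exact this

end

end EquivalentSimpleGraph

end

/-! ### The proposition for linear and for periodic time -/

theorem proposition6 {m : ℕ} {V S : Type*} [Fintype V] [LinearOrder V]
    (G : EquivalentSimpleGraph m V S) (hG : G.graph.Connected)
    (ψ : ℝ → ℝ) (hψ : IsCompletelyMonotone ψ)
    (hne : ∃ x y : ℝ, 0 ≤ x ∧ 0 ≤ y ∧ ψ x ≠ ψ y) :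
    -- linear time
    (∀ kT : ℕ → ℝ, kT 0 = 1 →
      IsPosSemidefKernel (fun t₁ t₂ : Fin m => kT (Nat.dist t₁ t₂)) →
      (∀ (Ω : Type*) [MeasurableSpace Ω] (P : Measure Ω) [IsProbabilityMeasure P]
        (ZV ZE : G.Point → Ω → ℝ), G.IsLinearConstruction kT P ZV ZE →
        ∀ u₁ u₂ : G.Point,
          Var[fun ω => (ZV u₁ ω + ZE u₁ ω) - (ZV u₂ ω + ZE u₂ ω); P]
            = G.linearDist kT u₁ u₂) ∧
      IsStrictlyPosDefKernel (fun u₁ u₂ : G.Point => ψ (G.linearDist kT u₁ u₂))) ∧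
    -- circular time
    (G.IsPeriodic → ∀ ρ lam β : ℝ, 0 ≤ ρ → ρ < 1 / 2 → -1 < lam → lam < 1 → 0 < β →
      (∀ (Ω : Type*) [MeasurableSpace Ω] (P : Measure Ω) [IsProbabilityMeasure P]
        (ZV ZE : G.Point → Ω → ℝ) (W : ℝ≥0 → Ω → ℝ),
        G.IsPeriodicConstruction ρ lam P ZV ZE W →
        ∀ p₁ p₂ : G.PeriodicPoint,
          Var[fun ω => (ZV p₁.1.2 ω + ZE p₁.1.2 ω + β * W p₁.1.1 ω)
              - (ZV p₂.1.2 ω + ZE p₂.1.2 ω + β * W p₂.1.1 ω); P]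
            = G.periodicDist ρ lam β p₁ p₂) ∧
      IsStrictlyPosDefKernel
        (fun p₁ p₂ : G.PeriodicPoint => ψ (G.periodicDist ρ lam β p₁ p₂))) := by
  refine ⟨fun kT _ hkT => ⟨fun Ω _ P _ ZV ZE h u₁ u₂ => h.variance_sub u₁ u₂, ?_⟩,
    fun hper ρ lam β hρ0 hρ1 hl1 hl2 hβ =>
      ⟨fun Ω _ P _ ZV ZE W h p₁ p₂ => h.variance_sub β p₁ p₂, ?_⟩⟩
  · exact hψ.isStrictlyPosDefKernel hne
      (EquivalentSimpleGraph.isPosSemidefKernel_linearKernel hkT)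
      fun _ _ h => EquivalentSimpleGraph.linearDist_ne_zero hG hkT h
  · exact hψ.isStrictlyPosDefKernel hne
      (EquivalentSimpleGraph.isPosSemidefKernel_periodicKernel hper.1 hρ0 hρ1 hl1 hl2 β)
      fun _ _ h => EquivalentSimpleGraph.periodicDist_ne_zero hG hper.1 hρ0 hρ1 hl1 hl2 hβ h
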